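/- Let $\mathfrak H$ be a complex Hilbert space, $U$ a unitary operator on $\mathfrak H$ with spectral measure $E$ on the circle $S^1=\mathbb R/2\pi\mathbb Z$, so that $U=\int_{S^1}e^{-i\theta}\,E(d\theta)$, and let $\varphi\in\mathfrak H$ with $\|\varphi\|=1$. For $t\ge1$ let $P_t$ be the orthogonal projection onto the line spanned by $U^{-t}\varphi$, let $J(t)=\|(1-P_{t-1})\cdots(1-P_1)\varphi\|^2$ (with $J(1)=1$), and let $J_\infty=\lim_{t\to\infty}J(t)$ be the asymptotic current of the one-state trap $A=|\varphi\rangle\langle\varphi|$. Suppose that the probability measure $\mu(d\theta)=\|E(d\theta)\varphi\|^2$ on $S^1$ is absolutely continuous with respect to Lebesgue measure $d\theta$, and let $\rho$ be its density with respect to normalised Lebesgue measure, $\mu(d\theta)=\rho(\theta)\,\frac{d\theta}{2\pi}$. Then the Hilbert transform of $\rho$, $$(\mathcal H\rho)(\eta)=\lim_{\delta\downarrow0}\frac1{4\pi}\int_{\delta\le|\eta-\theta|\le\pi}\rho(\theta)\cot\Bigl(\frac{\eta-\theta}{2}\Bigr)\,d\theta,$$ exists for Lebesgue-almost every $\eta$,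 the limit $J_\infty$ exists, and $$J_\infty=\frac1{2\pi}\int_{S^1}\frac{4\rho(\theta)}{(1+\rho(\theta))^2+4(\mathcal H\rho)(\theta)^2}\,d\theta>0.$$ -/

import Mathlib

open MeasureTheory Filter Topology
open scoped Real ENNReal InnerProductSpace

namespace QuantumTrap

instance instFactTwoPiPos : Fact (0 < 2 * π) := ⟨Real.two_pi_pos⟩

/-- A projection-valued measure on a measurable space `α` with values in the orthogonal
projections of the complex Hilbert space `H`, countably additive in the strong topology. -/
structure ProjectionValuedMeasure (α : Type*) [MeasurableSpace α]
    (H : Type*) [NormedAddCommGroup H] [InnerProductSpace ℂ H] [CompleteSpace H] where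
  /-- The projection `E B` attached to a set `B` (only its values on measurable sets matter). -/
  proj : Set α → H →L[ℂ] H
  isStarProjection : ∀ B : Set α, MeasurableSet B → IsStarProjection (proj B)
  proj_univ : proj Set.univ = 1
  proj_inter : ∀ B C : Set α, MeasurableSet B → MeasurableSet C →
    proj (B ∩ C) = proj B * proj C
  hasSum_iUnion : ∀ B : ℕ → Set α, (∀ n, MeasurableSet (B n)) →
    Pairwise (Function.onFun Disjoint B) →
    ∀ x : H, HasSum (fun n => proj (B n) x) (proj (⋃ n, B n) x)

section

variable {α : Type*} [MeasurableSpace α]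
  {H : Type*} [NormedAddCommGroup H] [InnerProductSpace ℂ H] [CompleteSpace H]

theorem ProjectionValuedMeasure.proj_empty_apply (E : ProjectionValuedMeasure α H) (x : H) :
    E.proj ∅ x = 0 := by
  have h := E.hasSum_iUnion (fun _ => ∅) (fun _ => MeasurableSet.empty)
    (fun _ _ _ => by simp [Function.onFun]) x
  have h0 := h.summable.tendsto_atTop_zero
  exact tendsto_nhds_unique tendsto_const_nhds h0

theorem ProjectionValuedMeasure.norm_sq_proj (E : ProjectionValuedMeasure α H) (x : H)
    {B : Set α} (hB : MeasurableSet B) : ‖E.proj B x‖ ^ 2 = (⟪x, E.proj B x⟫_ℂ).re := by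
  obtain ⟨hi, hs⟩ := E.isStarProjection B hB
  have h1 : E.proj B (E.proj B x) = E.proj B x := by
    have := congrArg (fun T : H →L[ℂ] H => T x) hi.eq
    simpa using this
  have h2 : ⟪E.proj B x, E.proj B x⟫_ℂ = ⟪x, E.proj B x⟫_ℂ := by
    have h3 := (ContinuousLinearMap.isSelfAdjoint_iff_isSymmetric.mp hs) x (E.proj B x)
    simp only [ContinuousLinearMap.coe_coe] at h3
    rw [h3, h1]
  rw [← h2, inner_self_eq_norm_sq_to_K]
  norm_cast

theorem ProjectionValuedMeasure.ofReal_norm_sq_iUnion (E : ProjectionValuedMeasure α H) (x : H)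
    (B : ℕ → Set α) (hB : ∀ n, MeasurableSet (B n)) (hd : Pairwise (Function.onFun Disjoint B)) :
    ENNReal.ofReal (‖E.proj (⋃ n, B n) x‖ ^ 2) = ∑' n, ENNReal.ofReal (‖E.proj (B n) x‖ ^ 2) := by
  have h1 := E.hasSum_iUnion B hB hd x
  have h2 : HasSum (fun n => ‖E.proj (B n) x‖ ^ 2) (‖E.proj (⋃ n, B n) x‖ ^ 2) := by
    simp only [E.norm_sq_proj x (MeasurableSet.iUnion hB), E.norm_sq_proj x (hB _)]
    exact Complex.reCLM.hasSum ((innerSL ℂ x).hasSum h1)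
  rw [← h2.tsum_eq, ENNReal.ofReal_tsum_of_nonneg (fun n => sq_nonneg _) h2.summable]

/-- The scalar measure `B ↦ ‖E B x‖²`. -/
noncomputable def ProjectionValuedMeasure.measureAt (E : ProjectionValuedMeasure α H) (x : H) :
    Measure α :=
  Measure.ofMeasurable (fun B _ => ENNReal.ofReal (‖E.proj B x‖ ^ 2))
    (by simp [E.proj_empty_apply x])
    (fun B hB hd => E.ofReal_norm_sq_iUnion x B hB hd)

/-- `E` is the spectral measure of the unitary `U`, i.e. `U = ∫ e^{-iθ} E(dθ)` over the circle
`ℝ / 2πℤ`, the integral being understood in the weak sense. -/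
def IsSpectralMeasure (U : unitary (H →L[ℂ] H))
    (E : ProjectionValuedMeasure (AddCircle (2 * π)) H) : Prop :=
  ∀ x : H, ⟪x, (U : H →L[ℂ] H) x⟫_ℂ =
    ∫ θ : AddCircle (2 * π), (AddCircle.toCircle (-θ) : ℂ) ∂(E.measureAt x)

/-- The orthogonal projection `P_t` onto the line spanned by `U^{-t} φ`. -/
noncomputable def trapProj (U : unitary (H →L[ℂ] H)) (φ : H) (t : ℕ) : H →L[ℂ] H :=
  (ℂ ∙ ((U ^ (-(t : ℤ)) : unitary (H →L[ℂ] H)) : H →L[ℂ] H) φ).starProjection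

/-- The vector `(1 - P_n) ⋯ (1 - P_1) φ`. -/
noncomputable def survivor (U : unitary (H →L[ℂ] H)) (φ : H) : ℕ → H
  | 0 => φ
  | n + 1 => (1 - trapProj U φ (n + 1)) (survivor U φ n)

/-- The current `J(t) = ‖(1 - P_{t-1}) ⋯ (1 - P_1) φ‖²` for `t ≥ 1`, so that `J(1) = ‖φ‖²`. -/
noncomputable def current (U : unitary (H →L[ℂ] H)) (φ : H) (t : ℕ) : ℝ :=
  ‖survivor U φ (t - 1)‖ ^ 2

end

/-- The density of `μ` with respect to the normalised Lebesgue measure `dθ / 2π`. -/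
noncomputable def density (μ : Measure (AddCircle (2 * π))) (θ : AddCircle (2 * π)) : ℝ :=
  (μ.rnDeriv AddCircle.haarAddCircle θ).toReal

/-- The truncated integral
`(1 / 4π) ∫_{δ ≤ |η - θ|} ρ(θ) cot((η - θ) / 2) dθ`, in the variable `x = η - θ ∈ (-π, π]`. -/
noncomputable def truncatedHilbert (ρ : AddCircle (2 * π) → ℝ) (η : AddCircle (2 * π))
    (δ : ℝ) : ℝ :=
  1 / (4 * π) * ∫ x in {x : ℝ | x ∈ Set.Ioc (-π) π ∧ δ ≤ |x|},
    ρ (η - (x : AddCircle (2 * π))) * Real.cot (x / 2)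

/-- The Hilbert transform (conjugate function) of `ρ`, as a principal value. -/
noncomputable def hilbertTransform (ρ : AddCircle (2 * π) → ℝ) (η : AddCircle (2 * π)) : ℝ :=
  limUnder (𝓝[>] (0 : ℝ)) (truncatedHilbert ρ η)

end QuantumTrap

open QuantumTrap

/-!
Write `r_k = ⟨φ, U ^ k φ⟩` for the return amplitudes and `b_0 = 1`, `b_1`, `b_2`, … for the
coefficients of the surviving vector along the orbit `U ^ (-k) φ`, so that `-b_k` is the amplitude
caught at time `k`.  Expanding the projections gives the renewal equation
`(∑ b_k z ^ k) (∑ r_k z ^ k) = 1` (`sum_survivalCoeff_mul_returnAmp`), and Pythagoras gives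
`J(t) = 2 - ∑_{k < t} |b_k| ^ 2` (`norm_sq_survivor`).  So `J_∞` exists, `b` is square summable, and
it remains to compute `∑ |b_k| ^ 2` from the boundary values of `1 / r`.

The weak spectral representation of `U` extends to its powers (`inner_pow_eq_integral`), so the
`r_k` are the Fourier coefficients of `ρ`, and `r(z) = ∑ r_k z ^ k` is its Cauchy integral.
Let `g ∈ L²` be the function on the circle with Fourier coefficients `b_k`.  Its
Poisson integral is `∑ b_k z ^ k = 1 / r(z)`, which therefore tends radially to `g` at the Lebesgue
points of `g` (`tendsto_tsum_radial`).  As `Re r ≥ 1 / 2`, the function `1 / r` has positive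
real part, and a mean value argument shows `g ≠ 0` almost everywhere
(`ae_ne_zero_of_radial_limit`).  Hence `r` has the finite radial limit `1 / g` almost everywhere.

The real part of `r` is, up to a constant, the Poisson integral of `ρ / 2`, and so tends to
`(1 + ρ) / 2`.  Its imaginary part differs from the Hilbert transform truncated at `1 - |z|` by the
integral of `ρ` against an odd kernel that the Poisson profile dominates; at Lebesgue points
this difference tends to `0` (`tendsto_integral_cauchyKernel_im_sub_hilbertKernel`).  So the
principal value `𝓗ρ` exists almost everywhere, without any weak-type estimate, and
`1 / g = (1 + ρ) / 2 + i 𝓗ρ` (`exists_boundary_value`).  Finally `∫ g = b_0 = 1` and Parseval give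
`J_∞ = ∫ (2 Re g - |g| ^ 2)` in the normalised measure, and the integrand is
`4 ρ / ((1 + ρ) ^ 2 + 4 (𝓗ρ) ^ 2)`.
-/

namespace QuantumTrap

/-! ### Powers of an operator given by its spectral measure -/

/-- The operator norm is at most twice the numerical radius. -/
theorem opNorm_le_of_inner_le {H : Type*} [NormedAddCommGroup H] [InnerProductSpace ℂ H]
    {T : H →L[ℂ] H} {ε : ℝ} (hε : 0 ≤ ε)
    (h : ∀ x, ‖⟪x, T x⟫_ℂ‖ ≤ ε * ‖x‖ ^ 2) : ‖T‖ ≤ 2 * ε := by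
  -- for unit vectors, polarisation and the parallelogram law give `‖⟪T x, y⟫‖ ≤ 2 ε`
  have hu : ∀ x y : H, ‖x‖ = 1 → ‖y‖ = 1 → ‖⟪T x, y⟫_ℂ‖ ≤ 2 * ε := by
    intro x y hx hy
    have h' : ∀ x, ‖⟪T x, x⟫_ℂ‖ ≤ ε * ‖x‖ ^ 2 := fun x => by rw [norm_inner_symm]; exact h x
    have hp := inner_map_polarization' (T : H →ₗ[ℂ] H) x y
    simp only [ContinuousLinearMap.coe_coe] at hp
    have p1 := parallelogram_law_with_norm ℂ x y
    have p2 := parallelogram_law_with_norm ℂ x (Complex.I • y)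
    have hI : ‖Complex.I • y‖ = 1 := by rw [norm_smul, Complex.norm_I, hy, one_mul]
    rw [hx, hy] at p1
    rw [hx, hI] at p2
    rw [hp, norm_div]
    have hn : ‖⟪T (x + y), x + y⟫_ℂ - ⟪T (x - y), x - y⟫_ℂ
        - Complex.I * ⟪T (x + Complex.I • y), x + Complex.I • y⟫_ℂ
        + Complex.I * ⟪T (x - Complex.I • y), x - Complex.I • y⟫_ℂ‖ ≤
        ε * ‖x + y‖ ^ 2 + ε * ‖x - y‖ ^ 2 + ε * ‖x + Complex.I • y‖ ^ 2
          + ε * ‖x - Complex.I • y‖ ^ 2 := by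
      refine (norm_add_le _ _).trans (add_le_add ((norm_sub_le _ _).trans (add_le_add
        ((norm_sub_le _ _).trans (add_le_add (h' _) (h' _))) ?_)) ?_)
      · rw [norm_mul, Complex.norm_I, one_mul]; exact h' _
      · rw [norm_mul, Complex.norm_I, one_mul]; exact h' _
    rw [show ‖(4 : ℂ)‖ = 4 by simp, div_le_iff₀ (by norm_num)]
    refine hn.trans (le_of_eq ?_)
    linear_combination ε * p1 + ε * p2
  refine T.opNorm_le_of_unit_norm (𝕜 := ℂ) (by positivity) fun x hx => ?_
  by_cases h0 : T x = 0
  · rw [h0, norm_zero]; positivity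
  have hne : (‖T x‖ : ℂ) ≠ 0 := by exact_mod_cast norm_ne_zero_iff.2 h0
  have h1 := hu x ((‖T x‖ : ℂ)⁻¹ • T x) hx (by
    rw [norm_smul, norm_inv, Complex.norm_real, norm_norm,
      inv_mul_cancel₀ (norm_ne_zero_iff.2 h0)])
  rw [inner_smul_right, inner_self_eq_norm_sq_to_K] at h1
  have h2 : (‖T x‖ : ℂ)⁻¹ * (‖T x‖ : ℂ) ^ 2 = (‖T x‖ : ℂ) := by field_simp
  simpa [h2] using h1

section SpectralMoments

variable {α : Type*} [MeasurableSpace α]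
  {H : Type*} [NormedAddCommGroup H] [InnerProductSpace ℂ H] [CompleteSpace H]

namespace ProjectionValuedMeasure

theorem measureAt_apply (E : ProjectionValuedMeasure α H) (x : H) {B : Set α}
    (hB : MeasurableSet B) : E.measureAt x B = ENNReal.ofReal (‖E.proj B x‖ ^ 2) :=
  Measure.ofMeasurable_apply B hB

theorem measureAt_univ (E : ProjectionValuedMeasure α H) (x : H) :
    E.measureAt x Set.univ = ENNReal.ofReal (‖x‖ ^ 2) := by
  simp [E.measureAt_apply x MeasurableSet.univ, E.proj_univ]

instance (E : ProjectionValuedMeasure α H) (x : H) : IsFiniteMeasure (E.measureAt x) :=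
  ⟨by rw [E.measureAt_univ]; exact ENNReal.ofReal_lt_top⟩

theorem measureAt_real (E : ProjectionValuedMeasure α H) (x : H) {B : Set α}
    (hB : MeasurableSet B) : (E.measureAt x).real B = ‖E.proj B x‖ ^ 2 := by
  rw [Measure.real, E.measureAt_apply x hB, ENNReal.toReal_ofReal (sq_nonneg _)]

theorem inner_proj (E : ProjectionValuedMeasure α H) (x : H) {B : Set α}
    (hB : MeasurableSet B) : ⟪x, E.proj B x⟫_ℂ = ((E.measureAt x).real B : ℂ) := by
  obtain ⟨hi, hs⟩ := E.isStarProjection B hB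
  have h1 : E.proj B (E.proj B x) = E.proj B x := by
    simpa using congrArg (fun T : H →L[ℂ] H => T x) hi.eq
  have h2 := (ContinuousLinearMap.isSelfAdjoint_iff_isSymmetric.mp hs) x (E.proj B x)
  simp only [ContinuousLinearMap.coe_coe] at h2
  rw [E.measureAt_real x hB, ← h1, ← h2, h1, inner_self_eq_norm_sq_to_K]
  norm_cast

theorem proj_mul_of_disjoint (E : ProjectionValuedMeasure α H) {B C : Set α}
    (hB : MeasurableSet B) (hC : MeasurableSet C) (h : Disjoint B C) :
    E.proj B * E.proj C = 0 := by
  rw [← E.proj_inter B C hB hC, h.inter_eq]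
  ext x
  exact E.proj_empty_apply x

/-- The spectral integral `∫ s dE` of a simple function `s`. -/
noncomputable def simpleIntegral (E : ProjectionValuedMeasure α H) (s : SimpleFunc α ℂ) :
    H →L[ℂ] H :=
  ∑ c ∈ s.range, c • E.proj (s ⁻¹' {c})

theorem simpleIntegral_pow_succ (E : ProjectionValuedMeasure α H) (s : SimpleFunc α ℂ) (k : ℕ) :
    E.simpleIntegral s ^ (k + 1) = ∑ c ∈ s.range, c ^ (k + 1) • E.proj (s ⁻¹' {c}) := by
  induction k with
  | zero => simp [simpleIntegral]
  | succ k ih =>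
    rw [pow_succ, ih, simpleIntegral, Finset.sum_mul]
    refine Finset.sum_congr rfl fun c hc => ?_
    rw [Finset.mul_sum, Finset.sum_eq_single_of_mem c hc]
    · rw [smul_mul_smul_comm, ← E.proj_inter _ _ (s.measurableSet_fiber c)
        (s.measurableSet_fiber c), Set.inter_self, ← pow_succ]
    · intro d _ hd
      rw [smul_mul_smul_comm, E.proj_mul_of_disjoint (s.measurableSet_fiber c)
        (s.measurableSet_fiber d), smul_zero]
      exact Disjoint.preimage _ (Set.disjoint_singleton.2 hd.symm)

theorem inner_simpleIntegral_pow_succ (E : ProjectionValuedMeasure α H) (s : SimpleFunc α ℂ)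
    (x : H) (k : ℕ) :
    ⟪x, (E.simpleIntegral s ^ (k + 1)) x⟫_ℂ = ∫ a, s a ^ (k + 1) ∂(E.measureAt x) := by
  have h := SimpleFunc.map_integral s (fun z : ℂ => z ^ (k + 1))
    (SimpleFunc.integrable_of_isFiniteMeasure (μ := E.measureAt x) s) (by simp)
  rw [SimpleFunc.integral_eq_integral _ (SimpleFunc.integrable_of_isFiniteMeasure _)] at h
  simp only [SimpleFunc.coe_map, Function.comp_apply] at h
  rw [h, E.simpleIntegral_pow_succ]
  simp only [sum_apply, smul_apply, inner_sum, inner_smul_right]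
  refine Finset.sum_congr rfl fun c _ => ?_
  rw [E.inner_proj x (s.measurableSet_fiber c), mul_comm, Complex.real_smul]

end ProjectionValuedMeasure

/-- A bounded measurable complex function is a uniform limit of simple functions. -/
theorem exists_simpleFunc_dist_le {f : α → ℂ} (hf : Measurable f) {M : ℝ}
    (hM : ∀ a, ‖f a‖ ≤ M) {ε : ℝ} (hε : 0 < ε) :
    ∃ s : SimpleFunc α ℂ, ∀ a, ‖f a - s a‖ ≤ ε := by
  have hcover : Metric.closedBall (0 : ℂ) M ⊆
      ⋃ n, Metric.ball (TopologicalSpace.denseSeq ℂ n) ε := by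
    intro z _
    obtain ⟨n, hn⟩ := (TopologicalSpace.denseRange_denseSeq ℂ).exists_dist_lt z hε
    exact Set.mem_iUnion.2 ⟨n, hn⟩
  obtain ⟨t, ht⟩ := (isCompact_closedBall (0 : ℂ) M).elim_finite_subcover _
    (fun _ => Metric.isOpen_ball) hcover
  refine ⟨(SimpleFunc.nearestPt (TopologicalSpace.denseSeq ℂ) (t.sup id)).comp f hf, fun a => ?_⟩
  have ha : f a ∈ Metric.closedBall (0 : ℂ) M := by simpa using hM a
  obtain ⟨n, hn, hd⟩ := Set.mem_iUnion₂.1 (ht ha)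
  have h1 := SimpleFunc.edist_nearestPt_le (TopologicalSpace.denseSeq ℂ) (f a)
    (Finset.le_sup (f := id) hn)
  rw [edist_dist, edist_dist, ENNReal.ofReal_le_ofReal_iff dist_nonneg] at h1
  rw [← dist_eq_norm, dist_comm]
  exact h1.trans ((dist_comm _ _).trans_le (Metric.mem_ball.1 hd).le)

/-- If `T = ∫ f dE` weakly with `f` bounded, then `T ^ k = ∫ f ^ k dE` weakly.  The operator `T`
is the norm limit of spectral integrals of simple functions, for which the claim is the
orthogonality of the projections of disjoint sets. -/
theorem inner_pow_eq_integral (E : ProjectionValuedMeasure α H) {T : H →L[ℂ] H} {f : α → ℂ}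
    (hf : Measurable f) {M : ℝ} (hM : ∀ a, ‖f a‖ ≤ M)
    (hT : ∀ x : H, ⟪x, T x⟫_ℂ = ∫ a, f a ∂(E.measureAt x)) (x : H) (k : ℕ) :
    ⟪x, (T ^ k) x⟫_ℂ = ∫ a, f a ^ k ∂(E.measureAt x) := by
  rcases k with _ | k
  · have h := E.inner_proj x MeasurableSet.univ
    rw [E.proj_univ] at h
    simp only [pow_zero, h, integral_const, Complex.real_smul, mul_one]
  have hpos : ∀ n : ℕ, (0 : ℝ) < 1 / ((n : ℝ) + 1) := fun n => by positivity
  choose s hs using fun n : ℕ => exists_simpleFunc_dist_le hf hM (hpos n)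
  have hlim : Tendsto (fun n : ℕ => 1 / ((n : ℝ) + 1)) atTop (𝓝 0) :=
    tendsto_one_div_add_atTop_nhds_zero_nat
  have hfint : ∀ y, Integrable f (E.measureAt y) := fun y =>
    Integrable.of_bound hf.aestronglyMeasurable M (Eventually.of_forall hM)
  have hST : ∀ n, ‖T - E.simpleIntegral (s n)‖ ≤ 2 * (1 / ((n : ℝ) + 1)) := by
    intro n
    refine opNorm_le_of_inner_le (hpos n).le fun y => ?_
    have h1 := E.inner_simpleIntegral_pow_succ (s n) y 0
    simp only [zero_add, pow_one] at h1
    rw [sub_apply, inner_sub_right, h1, hT,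
      ← integral_sub (hfint y) (SimpleFunc.integrable_of_isFiniteMeasure _)]
    refine (norm_integral_le_of_norm_le_const (Eventually.of_forall (hs n))).trans (le_of_eq ?_)
    rw [E.measureAt_real y MeasurableSet.univ, E.proj_univ, one_apply_eq_self]
  have hS : Tendsto (fun n => E.simpleIntegral (s n)) atTop (𝓝 T) := by
    rw [tendsto_iff_norm_sub_tendsto_zero]
    refine squeeze_zero (fun _ => norm_nonneg _) (fun n => ?_) 
      (by simpa only [mul_zero] using hlim.const_mul 2)
    rw [norm_sub_rev]
    exact hST n
  have h1 : Tendsto (fun n => ⟪x, (E.simpleIntegral (s n) ^ (k + 1)) x⟫_ℂ) atTop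
      (𝓝 ⟪x, (T ^ (k + 1)) x⟫_ℂ) :=
    tendsto_const_nhds.inner
      (((ContinuousLinearMap.apply ℂ H x).continuous.tendsto _).comp (hS.pow (k + 1)))
  have h2 : Tendsto (fun n => ∫ a, s n a ^ (k + 1) ∂(E.measureAt x)) atTop
      (𝓝 (∫ a, f a ^ (k + 1) ∂(E.measureAt x))) := by
    refine tendsto_integral_of_dominated_convergence (fun _ => (M + 1) ^ (k + 1))
      (fun n => ((s n).measurable.pow_const _).aestronglyMeasurable) (integrable_const _)
      (fun n => Eventually.of_forall fun a => ?_) (Eventually.of_forall fun a => ?_)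
    · rw [norm_pow]
      refine pow_le_pow_left₀ (norm_nonneg _) ?_ _
      have h3 := norm_sub_norm_le (s n a) (f a)
      rw [norm_sub_rev] at h3
      have h4 : 1 / ((n : ℝ) + 1) ≤ 1 := by
        rw [div_le_one (by positivity)]; linarith [n.cast_nonneg (α := ℝ)]
      linarith [hs n a, hM a]
    · refine Tendsto.pow ?_ _
      rw [tendsto_iff_norm_sub_tendsto_zero]
      refine squeeze_zero (fun _ => norm_nonneg _) (fun n => ?_) hlim
      rw [norm_sub_rev]
      exact hs n a
  simp only [E.inner_simpleIntegral_pow_succ] at h1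
  exact tendsto_nhds_unique h1 h2

end SpectralMoments

end QuantumTrap

namespace QuantumTrap

/-! ### The renewal equation of the trap -/

section Renewal

variable {H : Type*} [NormedAddCommGroup H] [InnerProductSpace ℂ H] [CompleteSpace H]

/-- The return amplitude `⟨φ, U ^ k φ⟩`. -/
noncomputable def returnAmp (U : unitary (H →L[ℂ] H)) (φ : H) (k : ℕ) : ℂ :=
  ⟪φ, ((U : H →L[ℂ] H) ^ k) φ⟫_ℂ

/-- The translate `U ^ (-k) φ`. -/
noncomputable def orbit (U : unitary (H →L[ℂ] H)) (φ : H) (k : ℕ) : H :=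
  ((U ^ (-(k : ℤ)) : unitary (H →L[ℂ] H)) : H →L[ℂ] H) φ

/-- The coefficients of the surviving vector along the orbit `U ^ (-k) φ`: `1` for `k = 0`, and
minus the amplitude caught at time `k` for `k ≥ 1`. -/
noncomputable def survivalCoeff (U : unitary (H →L[ℂ] H)) (φ : H) : ℕ → ℂ
  | 0 => 1
  | k + 1 => -⟪orbit U φ (k + 1), survivor U φ k⟫_ℂ

variable (U : unitary (H →L[ℂ] H)) {φ : H}

theorem orbit_zero : orbit U φ 0 = φ := by simp [orbit]

theorem norm_orbit (k : ℕ) : ‖orbit U φ k‖ = ‖φ‖ :=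
  Unitary.norm_map _ _

theorem inner_orbit (i j : ℕ) : ⟪orbit U φ (i + j), orbit U φ j⟫_ℂ = returnAmp U φ i := by
  have h : orbit U φ j = ((U ^ (-((i + j : ℕ) : ℤ)) : unitary (H →L[ℂ] H)) : H →L[ℂ] H)
      (((U : H →L[ℂ] H) ^ i) φ) := by
    have h1 : (U ^ (-(j : ℤ)) : unitary (H →L[ℂ] H)) = U ^ (-((i + j : ℕ) : ℤ)) * U ^ i := by
      rw [← zpow_natCast, ← zpow_add]
      congr 1
      push_cast
      ring
    rw [orbit, h1]
    simp
  rw [h, orbit, Unitary.inner_map_map, returnAmp]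

theorem survivor_succ (hφ : ‖φ‖ = 1) (n : ℕ) :
    survivor U φ (n + 1) = survivor U φ n + survivalCoeff U φ (n + 1) • orbit U φ (n + 1) := by
  have h := Submodule.starProjection_unit_singleton ℂ
    (v := orbit U φ (n + 1)) (by rw [norm_orbit, hφ]) (survivor U φ n)
  have h' : trapProj U φ (n + 1) (survivor U φ n) =
      ⟪orbit U φ (n + 1), survivor U φ n⟫_ℂ • orbit U φ (n + 1) := h
  rw [survivor, sub_apply, one_apply_eq_self, h', survivalCoeff, neg_smul, sub_eq_add_neg]

theorem survivor_eq_sum (hφ : ‖φ‖ = 1) (n : ℕ) :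
    survivor U φ n = ∑ j ∈ Finset.range (n + 1), survivalCoeff U φ j • orbit U φ j := by
  induction n with
  | zero => simp [survivor, survivalCoeff, orbit_zero]
  | succ n ih => rw [survivor_succ U hφ, ih, ← Finset.sum_range_succ]

theorem returnAmp_zero (hφ : ‖φ‖ = 1) : returnAmp U φ 0 = 1 := by
  simp [returnAmp, inner_self_eq_norm_sq_to_K, hφ]

/-- The renewal equation: the power series of the survival coefficients and of the return
amplitudes are inverse to each other. -/
theorem sum_survivalCoeff_mul_returnAmp (hφ : ‖φ‖ = 1) (n : ℕ) :
    ∑ j ∈ Finset.range (n + 1), survivalCoeff U φ j * returnAmp U φ (n - j) =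
      if n = 0 then 1 else 0 := by
  rcases n with _ | n
  · simp [survivalCoeff, returnAmp_zero U hφ]
  rw [Finset.sum_range_succ, Nat.sub_self,
    returnAmp_zero U hφ, mul_one, if_neg n.succ_ne_zero]
  have h : ∑ j ∈ Finset.range (n + 1), survivalCoeff U φ j * returnAmp U φ (n + 1 - j) =
      ⟪orbit U φ (n + 1), survivor U φ n⟫_ℂ := by
    rw [survivor_eq_sum U hφ, inner_sum]
    refine Finset.sum_congr rfl fun j hj => ?_
    have hj' : n + 1 - j + j = n + 1 := Nat.sub_add_cancel (Finset.mem_range.1 hj).le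
    rw [inner_smul_right, ← inner_orbit U (n + 1 - j) j, hj']
  rw [h, survivalCoeff, add_neg_cancel]

theorem norm_sq_survivor (hφ : ‖φ‖ = 1) (n : ℕ) :
    ‖survivor U φ n‖ ^ 2 = 2 - ∑ j ∈ Finset.range (n + 1), ‖survivalCoeff U φ j‖ ^ 2 := by
  induction n with
  | zero => norm_num [survivor, survivalCoeff, hφ]
  | succ n ih =>
    rw [Finset.sum_range_succ, survivor_succ U hφ, ← sub_sub, ← ih, norm_add_sq (𝕜 := ℂ),
      norm_smul, norm_orbit, hφ, inner_smul_right, mul_one]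
    have h : ⟪survivor U φ n, orbit U φ (n + 1)⟫_ℂ =
        -(starRingEnd ℂ) (survivalCoeff U φ (n + 1)) := by
      rw [survivalCoeff, map_neg, neg_neg, inner_conj_symm]
    rw [h, mul_neg, Complex.mul_conj, Complex.normSq_eq_norm_sq]
    simp only [map_neg]
    have : RCLike.re (((‖survivalCoeff U φ (n + 1)‖ ^ 2 : ℝ) : ℂ)) =
      ‖survivalCoeff U φ (n + 1)‖ ^ 2 := Complex.ofReal_re _
    rw [this]
    ring

theorem sum_norm_sq_survivalCoeff_le (hφ : ‖φ‖ = 1) (n : ℕ) :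
    ∑ j ∈ Finset.range n, ‖survivalCoeff U φ j‖ ^ 2 ≤ 2 := by
  refine (Finset.sum_le_sum_of_subset_of_nonneg (Finset.range_mono n.le_succ)
    fun _ _ _ => sq_nonneg _).trans ?_
  linarith [norm_sq_survivor U hφ n, sq_nonneg ‖survivor U φ n‖]

theorem summable_norm_sq_survivalCoeff (hφ : ‖φ‖ = 1) :
    Summable fun j => ‖survivalCoeff U φ j‖ ^ 2 :=
  summable_of_sum_range_le (fun _ => sq_nonneg _) (sum_norm_sq_survivalCoeff_le U hφ)

theorem norm_returnAmp_le (hφ : ‖φ‖ = 1) (k : ℕ) : ‖returnAmp U φ k‖ ≤ 1 := by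
  have h := norm_inner_le_norm (𝕜 := ℂ) (orbit U φ (k + 0)) (orbit U φ 0)
  rwa [inner_orbit, norm_orbit, norm_orbit, hφ, mul_one] at h

theorem norm_survivalCoeff_le (hφ : ‖φ‖ = 1) (k : ℕ) : ‖survivalCoeff U φ k‖ ≤ 2 := by
  have h := (Finset.single_le_sum (f := fun j => ‖survivalCoeff U φ j‖ ^ 2)
    (fun _ _ => sq_nonneg _) (Finset.self_mem_range_succ k)).trans
      (sum_norm_sq_survivalCoeff_le U hφ (k + 1))
  nlinarith [norm_nonneg (survivalCoeff U φ k)]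

theorem tendsto_current (hφ : ‖φ‖ = 1) :
    Tendsto (current U φ) atTop (𝓝 (2 - ∑' j, ‖survivalCoeff U φ j‖ ^ 2)) := by
  have h := ((summable_norm_sq_survivalCoeff U hφ).hasSum.tendsto_sum_nat).const_sub 2
  refine h.congr' ?_
  filter_upwards [eventually_ge_atTop 1] with t ht
  rw [current, norm_sq_survivor U hφ, Nat.sub_add_cancel ht]

end Renewal

end QuantumTrap

namespace QuantumTrap

open AddCircle

/-! ### Approximation of the identity at Lebesgue points of the circle -/

section LebesguePoints

/-- `η` is a Lebesgue point of `f`: the mean of `‖f - f η‖` over the ball of radius `h` about `η`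
tends to `0` with `h`.  The measure of the ball is replaced by `h`, to which it is
proportional for small `h`. -/
def IsLebesguePoint (f : AddCircle (2 * π) → ℂ) (η : AddCircle (2 * π)) : Prop :=
  Tendsto (fun h : ℝ => h⁻¹ * ∫ y in Metric.closedBall η h, ‖f y - f η‖ ∂haarAddCircle)
    (𝓝[>] 0) (𝓝 0)

theorem absolutelyContinuous_volume_haarAddCircle :
    (volume : Measure (AddCircle (2 * π))) ≪ haarAddCircle := by
  rw [volume_eq_smul_haarAddCircle]
  exact Measure.smul_absolutelyContinuous

theorem absolutelyContinuous_haarAddCircle_volume :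
    (haarAddCircle : Measure (AddCircle (2 * π))) ≪ volume := by
  rw [volume_eq_smul_haarAddCircle]
  exact Measure.absolutelyContinuous_smul (by simp [Real.pi_pos])

theorem integrable_volume_iff {E : Type*} [NormedAddCommGroup E] {f : AddCircle (2 * π) → E} :
    Integrable f volume ↔ Integrable f haarAddCircle := by
  rw [volume_eq_smul_haarAddCircle]
  exact integrable_smul_measure (by simp [Real.pi_pos]) ENNReal.ofReal_ne_top

theorem ae_isLebesguePoint {f : AddCircle (2 * π) → ℂ} (hf : Integrable f haarAddCircle) :
    ∀ᵐ η : AddCircle (2 * π), IsLebesguePoint f η := by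
  have hf' : Integrable f (volume : Measure (AddCircle (2 * π))) := integrable_volume_iff.2 hf
  filter_upwards [IsUnifLocDoublingMeasure.ae_tendsto_average_norm_sub
    (volume : Measure (AddCircle (2 * π))) hf'.locallyIntegrable 1] with η hη
  have h1 := hη (l := 𝓝[>] (0 : ℝ)) (fun _ => η) id tendsto_id (by
    filter_upwards [self_mem_nhdsWithin] with h hh
    exact Metric.mem_closedBall_self (by simpa using (Set.mem_Ioi.1 hh).le))
  have h2 := h1.const_mul (π⁻¹ : ℝ)
  rw [mul_zero] at h2
  refine h2.congr' ?_
  filter_upwards [Ioo_mem_nhdsGT Real.pi_pos] with h hh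
  obtain ⟨h0, hπ⟩ := hh
  have hv : (volume : Measure (AddCircle (2 * π))).real (Metric.closedBall η h) = 2 * h := by
    rw [Measure.real, AddCircle.volume_closedBall, ENNReal.toReal_ofReal (by positivity)]
    exact min_eq_right (by linarith)
  rw [setAverage_eq, id, hv, volume_eq_smul_haarAddCircle, Measure.restrict_smul,
    integral_smul_measure, ENNReal.toReal_ofReal (by positivity), smul_eq_mul, smul_eq_mul]
  field_simp

variable {f : AddCircle (2 * π) → ℂ} {η : AddCircle (2 * π)}

/-- A dyadic decomposition into the balls of radius `2 ^ k * δ` about `η` bounds the integral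
against the profile `δ / (δ ^ 2 + ‖x‖ ^ 2)` by a geometrically weighted sum of means. -/
theorem integral_profile_le (hf : Integrable f haarAddCircle) {δ : ℝ} (hδ : 0 < δ) :
    ∃ N : ℕ, ∫ y, δ / (δ ^ 2 + ‖η - y‖ ^ 2) * ‖f y - f η‖ ∂haarAddCircle ≤
      ∑ k ∈ Finset.range N, 4 * (1 / 2) ^ k * ((2 ^ k * δ)⁻¹ *
        ∫ y in Metric.closedBall η (2 ^ k * δ), ‖f y - f η‖ ∂haarAddCircle) := by
  obtain ⟨N, hN⟩ : ∃ N : ℕ, π ≤ 2 ^ N * δ := by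
    obtain ⟨N, hN⟩ := pow_unbounded_of_one_lt (π / δ) (one_lt_two (α := ℝ))
    exact ⟨N, ((div_lt_iff₀ hδ).1 hN).le⟩
  refine ⟨N + 1, ?_⟩
  have hg : Integrable (fun y => ‖f y - f η‖) haarAddCircle :=
    (hf.sub (integrable_const _)).norm
  have hterm : ∀ k : ℕ, 4 * (1 / 2) ^ k * ((2 ^ k * δ)⁻¹ *
        ∫ y in Metric.closedBall η (2 ^ k * δ), ‖f y - f η‖ ∂haarAddCircle) =
      ∫ y, 4 / (4 ^ k * δ) * (Metric.closedBall η (2 ^ k * δ)).indicator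
        (fun y => ‖f y - f η‖) y ∂haarAddCircle := by
    intro k
    rw [integral_const_mul, integral_indicator Metric.isClosed_closedBall.measurableSet,
      ← mul_assoc]
    congr 1
    rw [show (4 : ℝ) ^ k = 2 ^ k * 2 ^ k by rw [← mul_pow]; norm_num, one_div, inv_pow]
    field_simp
  simp_rw [hterm]
  have hint : ∀ k ∈ Finset.range (N + 1), Integrable (fun y => 4 / (4 ^ k * δ) *
      (Metric.closedBall η (2 ^ k * δ)).indicator (fun y => ‖f y - f η‖) y) haarAddCircle :=
    fun k _ => (hg.indicator Metric.isClosed_closedBall.measurableSet).const_mul _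
  rw [← integral_finsetSum _ hint]
  refine integral_mono_of_nonneg (Eventually.of_forall fun y => by positivity)
    (integrable_finsetSum _ hint) (Eventually.of_forall fun y => ?_)
  have hy : ‖η - y‖ ≤ 2 ^ N * δ := by
    refine (AddCircle.norm_le_half_period _ (by positivity)).trans (le_trans (le_of_eq ?_) hN)
    rw [abs_of_pos Real.two_pi_pos]
    ring
  have hex : ∃ k : ℕ, ‖η - y‖ ≤ 2 ^ k * δ := ⟨N, hy⟩
  classical
  set k := Nat.find hex with hk
  have hkN : k ∈ Finset.range (N + 1) := Finset.mem_range_succ_iff.2 (Nat.find_min' hex hy)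
  have hky : ‖η - y‖ ≤ 2 ^ k * δ := Nat.find_spec hex
  refine le_trans ?_ (Finset.single_le_sum (f := fun k => 4 / (4 ^ k * δ) *
    (Metric.closedBall η (2 ^ k * δ)).indicator (fun y => ‖f y - f η‖) y) (fun j _ => ?_) hkN)
  · have hmem : y ∈ Metric.closedBall η (2 ^ k * δ) := by
      rw [Metric.mem_closedBall, dist_comm, dist_eq_norm]
      exact hky
    simp only
    rw [Set.indicator_of_mem hmem]
    refine mul_le_mul_of_nonneg_right ?_ (norm_nonneg _)
    rw [div_le_div_iff₀ (by positivity) (by positivity)]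
    rcases Nat.eq_zero_or_pos k with h0 | hpos
    · rw [h0]
      nlinarith [sq_nonneg ‖η - y‖, sq_nonneg δ]
    · have hlt : 2 ^ (k - 1) * δ < ‖η - y‖ := not_le.1 (Nat.find_min hex (Nat.sub_lt hpos one_pos))
      have h2 : (2 : ℝ) ^ k = 2 * 2 ^ (k - 1) := by
        rw [← pow_succ', Nat.sub_add_cancel hpos]
      have h3 : (2 ^ k * δ) ^ 2 ≤ 4 * ‖η - y‖ ^ 2 := by
        have : 2 ^ k * δ ≤ 2 * ‖η - y‖ := by rw [h2]; linarith
        calc (2 ^ k * δ) ^ 2 ≤ (2 * ‖η - y‖) ^ 2 := pow_le_pow_left₀ (by positivity) this 2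
          _ = 4 * ‖η - y‖ ^ 2 := by ring
      have h4 : (4 : ℝ) ^ k = 2 ^ k * 2 ^ k := by rw [← mul_pow]; norm_num
      rw [h4]
      nlinarith [sq_nonneg δ]
  · exact mul_nonneg (by positivity) (Set.indicator_nonneg (fun _ _ => norm_nonneg _) _)

theorem tendsto_integral_profile (hf : Integrable f haarAddCircle) (hη : IsLebesguePoint f η) :
    Tendsto (fun δ : ℝ => ∫ y, δ / (δ ^ 2 + ‖η - y‖ ^ 2) * ‖f y - f η‖ ∂haarAddCircle)
      (𝓝[>] 0) (𝓝 0) := by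
  set A : ℝ → ℝ :=
    fun h => h⁻¹ * ∫ y in Metric.closedBall η h, ‖f y - f η‖ ∂haarAddCircle with hA
  have hg : Integrable (fun y => ‖f y - f η‖) haarAddCircle :=
    (hf.sub (integrable_const _)).norm
  have hA0 : ∀ h, 0 < h → 0 ≤ A h := fun h hh =>
    mul_nonneg (inv_nonneg.2 hh.le) (integral_nonneg fun _ => norm_nonneg _)
  obtain ⟨M, hM⟩ : ∃ M, ∀ h, 0 < h → A h ≤ M := by
    have h1 : ∀ᶠ h in 𝓝[>] (0 : ℝ), A h < 1 := hη.eventually (gt_mem_nhds one_pos)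
    obtain ⟨h0, h0pos, h0le⟩ := (mem_nhdsGT_iff_exists_Ioo_subset).1 h1
    have h0pos' : 0 < h0 := h0pos
    refine ⟨max 1 (h0⁻¹ * ∫ y, ‖f y - f η‖ ∂haarAddCircle), fun h hh => ?_⟩
    rcases lt_or_ge h h0 with hlt | hge
    · exact (h0le ⟨hh, hlt⟩ : A h < 1).le.trans (le_max_left _ _)
    · refine le_trans ?_ (le_max_right _ _)
      exact mul_le_mul (inv_anti₀ h0pos' hge)
        (setIntegral_le_integral hg (Eventually.of_forall fun _ => norm_nonneg _))
        (integral_nonneg fun _ => norm_nonneg _) (inv_nonneg.2 h0pos'.le)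
  have hgeo : Summable fun k : ℕ => 4 * (1 / 2 : ℝ) ^ k * M :=
    (summable_geometric_two.mul_left 4).mul_right M
  have hbound : ∀ δ : ℝ, 0 < δ → ∀ k : ℕ, ‖4 * (1 / 2 : ℝ) ^ k * A (2 ^ k * δ)‖ ≤
      4 * (1 / 2 : ℝ) ^ k * M := by
    intro δ hδ k
    have hp : 0 < 2 ^ k * δ := by positivity
    rw [Real.norm_of_nonneg (mul_nonneg (by positivity) (hA0 _ hp))]
    exact mul_le_mul_of_nonneg_left (hM _ hp) (by positivity)
  have hlim : Tendsto (fun δ : ℝ => ∑' k : ℕ, 4 * (1 / 2 : ℝ) ^ k * A (2 ^ k * δ))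
      (𝓝[>] 0) (𝓝 0) := by
    have h1 := tendsto_tsum_of_dominated_convergence (𝓕 := 𝓝[>] (0 : ℝ))
      (f := fun δ (k : ℕ) => 4 * (1 / 2 : ℝ) ^ k * A (2 ^ k * δ)) (g := fun _ => (0 : ℝ)) hgeo
      (fun k => ?_) ?_
    · simpa only [tsum_zero] using h1
    · have h2 : Tendsto (fun δ : ℝ => 2 ^ k * δ) (𝓝[>] 0) (𝓝[>] 0) := by
        refine tendsto_nhdsWithin_iff.2 ⟨?_, ?_⟩
        · have := ((continuous_const_mul ((2 : ℝ) ^ k)).tendsto 0)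
          rw [mul_zero] at this
          exact this.mono_left nhdsWithin_le_nhds
        · filter_upwards [self_mem_nhdsWithin] with δ hδ
          exact Set.mem_Ioi.2 (mul_pos (pow_pos two_pos k) (Set.mem_Ioi.1 hδ))
      have h3 := (Tendsto.comp hη h2).const_mul (4 * (1 / 2 : ℝ) ^ k)
      rw [mul_zero] at h3
      exact h3
    · filter_upwards [self_mem_nhdsWithin] with δ hδ
      exact hbound δ hδ
  refine squeeze_zero' ?_ ?_ hlim
  · filter_upwards [self_mem_nhdsWithin] with δ hδ
    exact integral_nonneg fun y =>
      mul_nonneg (div_nonneg (Set.mem_Ioi.1 hδ).le (by positivity)) (norm_nonneg _)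
  · filter_upwards [self_mem_nhdsWithin] with δ hδ
    obtain ⟨N, hN⟩ := integral_profile_le (η := η) hf (Set.mem_Ioi.1 hδ)
    refine hN.trans (Summable.sum_le_tsum _ (fun k _ => ?_)
      (Summable.of_norm_bounded hgeo (hbound δ hδ)))
    exact mul_nonneg (by positivity) (hA0 _ (mul_pos (by positivity) hδ))

/-- Kernels dominated by the Poisson profile do not see `f - f η` in the limit, at a Lebesgue
point `η` of `f`. -/
theorem tendsto_integral_kernel_mul_sub (hf : Integrable f haarAddCircle)
    (hη : IsLebesguePoint f η) {k : ℝ → AddCircle (2 * π) → ℂ} {C : ℝ}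
    (hk : ∀ᶠ δ in 𝓝[>] 0, ∀ x, ‖k δ x‖ ≤ C * (δ / (δ ^ 2 + ‖x‖ ^ 2))) :
    Tendsto (fun δ : ℝ => ∫ y, k δ (η - y) * (f y - f η) ∂haarAddCircle) (𝓝[>] 0) (𝓝 0) := by
  have h := (tendsto_integral_profile hf hη).const_mul C
  rw [mul_zero] at h
  refine squeeze_zero_norm' ?_ h
  have hg : Integrable (fun y => ‖f y - f η‖) haarAddCircle :=
    (hf.sub (integrable_const _)).norm
  filter_upwards [hk, self_mem_nhdsWithin] with δ hδ hpos
  have hpos' : 0 < δ := hpos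
  refine (norm_integral_le_integral_norm _).trans ?_
  rw [← integral_const_mul]
  refine integral_mono_of_nonneg (Eventually.of_forall fun _ => norm_nonneg _) ?_
    (Eventually.of_forall fun y => ?_)
  · refine Integrable.const_mul (hg.bdd_mul (c := 1 / δ) ?_ (Eventually.of_forall fun y => ?_)) C
    · refine Continuous.aestronglyMeasurable ?_
      refine continuous_const.div (by fun_prop) fun y => by positivity
    · rw [Real.norm_of_nonneg (by positivity), div_le_div_iff₀ (by positivity) hpos']
      nlinarith [sq_nonneg ‖η - y‖]
  · simp only
    rw [norm_mul, ← mul_assoc]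
    exact mul_le_mul_of_nonneg_right (hδ _) (norm_nonneg _)

end LebesguePoints

end QuantumTrap

namespace QuantumTrap

open AddCircle

/-! ### Cauchy, Poisson and Hilbert kernels on the circle -/

section Kernels

theorem fourier_pow (m : ℤ) (k : ℕ) (x : AddCircle (2 * π)) :
    (fourier m x : ℂ) ^ k = fourier (k * m) x := by
  induction k with
  | zero => simp
  | succ k ih => rw [pow_succ, ih, ← fourier_add]; congr 2; push_cast; ring

theorem fourier_sub_apply (m : ℤ) (x y : AddCircle (2 * π)) :
    (fourier m (x - y) : ℂ) = fourier m x * fourier (-m) y := by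
  rw [fourier_neg, fourier_apply, fourier_apply, fourier_apply, smul_sub, sub_eq_add_neg,
    toCircle_add, toCircle_neg, Circle.coe_mul, Circle.coe_inv_eq_conj]

/-- The Cauchy kernel `1 / (1 - R e^{imx})`; `m = -1` gives the conjugate of `m = 1`. -/
noncomputable def cauchyKernel (m : ℤ) (R : ℝ) (x : AddCircle (2 * π)) : ℂ :=
  (1 - R * fourier m x)⁻¹

theorem one_sub_mul_fourier_ne_zero (m : ℤ) {R : ℝ} (h0 : 0 ≤ R) (h1 : R < 1)
    (x : AddCircle (2 * π)) : 1 - (R : ℂ) * fourier m x ≠ 0 := by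
  intro h
  have h2 : ‖(R : ℂ) * fourier m x‖ = R := by
    rw [norm_mul, fourier_apply, Circle.norm_coe, mul_one, Complex.norm_real,
      Real.norm_of_nonneg h0]
  rw [← sub_eq_zero.1 h, norm_one] at h2
  exact h1.ne h2.symm

theorem continuous_cauchyKernel (m : ℤ) {R : ℝ} (h0 : 0 ≤ R) (h1 : R < 1) :
    Continuous (cauchyKernel m R) :=
  Continuous.inv₀ (by fun_prop) (one_sub_mul_fourier_ne_zero m h0 h1)

/-- The Cauchy integral of `f` is the power series of its Fourier coefficients. -/
theorem hasSum_integral_cauchyKernel_mul (m : ℤ) {R : ℝ} (h0 : 0 ≤ R) (h1 : R < 1)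
    {f : AddCircle (2 * π) → ℂ} (hf : Integrable f haarAddCircle) (η : AddCircle (2 * π)) :
    HasSum (fun k : ℕ => (R * fourier m η : ℂ) ^ k * fourierCoeff f (k * m))
      (∫ y, cauchyKernel m R (η - y) * f y ∂haarAddCircle) := by
  have hnorm : ∀ (k : ℕ) (y : AddCircle (2 * π)), ‖((R : ℂ) * fourier m y) ^ k‖ = R ^ k := by
    intro k y
    rw [norm_pow, norm_mul, fourier_apply, Circle.norm_coe, mul_one, Complex.norm_real,
      Real.norm_of_nonneg h0]
  have hint : ∀ k : ℕ, Integrable (fun y => ((R : ℂ) * fourier m (η - y)) ^ k * f y)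
      haarAddCircle := fun k =>
    hf.bdd_mul (c := R ^ k) (Continuous.aestronglyMeasurable (by fun_prop))
      (Eventually.of_forall fun y => (hnorm k _).le)
  have h := hasSum_integral_of_summable_integral_norm hint (by
    simp_rw [norm_mul, hnorm, integral_const_mul]
    exact (summable_geometric_of_lt_one h0 h1).mul_right _)
  convert! h using 1
  · funext k
    rw [fourierCoeff, ← integral_const_mul]
    refine integral_congr_ae (Eventually.of_forall fun y => ?_)
    simp only [smul_eq_mul]
    rw [mul_pow, mul_pow, fourier_pow, fourier_pow, fourier_sub_apply]
    ring
  · refine integral_congr_ae (Eventually.of_forall fun y => ?_)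
    simp only
    rw [tsum_mul_right, tsum_geometric_of_norm_lt_one, cauchyKernel]
    have := hnorm 1 (η - y)
    rw [pow_one, pow_one] at this
    rwa [this]

/-- The Poisson kernel, as a combination of Cauchy kernels. -/
noncomputable def poissonKernel (R : ℝ) (x : AddCircle (2 * π)) : ℂ :=
  cauchyKernel 1 R x + cauchyKernel (-1) R x - 1

/-- The Hilbert kernel `cot (x / 2) / 2 = sin x / (2 (1 - cos x))`, truncated to `‖x‖ ≥ δ`. -/
noncomputable def hilbertKernel (δ : ℝ) (x : AddCircle (2 * π)) : ℝ :=
  if δ ≤ ‖x‖ then (fourier 1 x : ℂ).im / (2 * (1 - (fourier 1 x : ℂ).re)) else 0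

theorem exists_coe_eq (x : AddCircle (2 * π)) : ∃ t : ℝ, (t : AddCircle (2 * π)) = x ∧ |t| ≤ π := by
  obtain ⟨t, ht, rfl⟩ := AddCircle.coe_image_Ioc_eq (2 * π) (-π) ▸ Set.mem_univ x
  exact ⟨t, rfl, abs_le.2 ⟨ht.1.le, by linarith [ht.2]⟩⟩

theorem norm_coe_of_abs_le {t : ℝ} (ht : |t| ≤ π) : ‖(t : AddCircle (2 * π))‖ = |t| := by
  refine (AddCircle.norm_coe_eq_abs_iff (2 * π) Real.two_pi_pos.ne').2 (ht.trans (le_of_eq ?_))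
  rw [abs_of_pos Real.two_pi_pos]
  ring

theorem fourier_one_coe (t : ℝ) :
    (fourier 1 (t : AddCircle (2 * π)) : ℂ) = Complex.exp (t * Complex.I) := by
  have hp : (π : ℂ) ≠ 0 := by exact_mod_cast Real.pi_ne_zero
  rw [fourier_coe_apply]
  congr 1
  push_cast
  field_simp

theorem fourier_one_re (t : ℝ) : (fourier 1 (t : AddCircle (2 * π)) : ℂ).re = Real.cos t := by
  rw [fourier_one_coe, Complex.exp_ofReal_mul_I_re]

theorem fourier_one_im (t : ℝ) : (fourier 1 (t : AddCircle (2 * π)) : ℂ).im = Real.sin t := by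
  rw [fourier_one_coe, Complex.exp_ofReal_mul_I_im]

theorem fourier_one_sq_add_sq (x : AddCircle (2 * π)) :
    (fourier 1 x : ℂ).re ^ 2 + (fourier 1 x : ℂ).im ^ 2 = 1 := by
  obtain ⟨t, rfl, _⟩ := exists_coe_eq x
  rw [fourier_one_re, fourier_one_im, Real.cos_sq_add_sin_sq]

theorem abs_fourier_one_im_le (x : AddCircle (2 * π)) : |(fourier 1 x : ℂ).im| ≤ ‖x‖ := by
  obtain ⟨t, rfl, ht⟩ := exists_coe_eq x
  rw [fourier_one_im, norm_coe_of_abs_le ht]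
  exact Real.abs_sin_le_abs

theorem norm_sq_le_one_sub_fourier_one_re (x : AddCircle (2 * π)) :
    2 / π ^ 2 * ‖x‖ ^ 2 ≤ 1 - (fourier 1 x : ℂ).re := by
  obtain ⟨t, rfl, ht⟩ := exists_coe_eq x
  rw [fourier_one_re, norm_coe_of_abs_le ht, sq_abs]
  linarith [Real.cos_le_one_sub_mul_cos_sq ht]

theorem normSq_one_sub_mul_fourier (R : ℝ) (x : AddCircle (2 * π)) :
    Complex.normSq (1 - R * fourier 1 x) =
      (1 - R) ^ 2 + 2 * R * (1 - (fourier 1 x : ℂ).re) := by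
  rw [Complex.normSq_apply]
  simp only [Complex.sub_re, Complex.one_re, Complex.mul_re, Complex.ofReal_re,
    Complex.ofReal_im, zero_mul, sub_zero, Complex.sub_im, Complex.one_im, Complex.mul_im,
    add_zero, zero_sub]
  linear_combination R ^ 2 * fourier_one_sq_add_sq x

theorem le_normSq_one_sub_mul_fourier {δ : ℝ} (h0 : 0 < δ) (h1 : δ ≤ 1 / 2)
    (x : AddCircle (2 * π)) :
    (δ ^ 2 + ‖x‖ ^ 2) / 5 ≤ Complex.normSq (1 - ((1 - δ : ℝ) : ℂ) * fourier 1 x) := by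
  rw [normSq_one_sub_mul_fourier]
  have h2 := norm_sq_le_one_sub_fourier_one_re x
  have h3 : (1 : ℝ) / 5 ≤ 2 / π ^ 2 := by
    rw [div_le_div_iff₀ (by norm_num) (by positivity)]
    nlinarith [Real.pi_lt_d2, Real.pi_pos]
  have h4 := mul_le_mul_of_nonneg_right h3 (sq_nonneg ‖x‖)
  nlinarith [sq_nonneg ‖x‖, sq_nonneg δ]

theorem two_mul_div_normSq_le {δ : ℝ} (h0 : 0 < δ) (h1 : δ ≤ 1 / 2) (x : AddCircle (2 * π)) :
    2 * δ / Complex.normSq (1 - ((1 - δ : ℝ) : ℂ) * fourier 1 x) ≤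
      10 * (δ / (δ ^ 2 + ‖x‖ ^ 2)) := by
  have h := le_normSq_one_sub_mul_fourier h0 h1 x
  have hp : 0 < (δ ^ 2 + ‖x‖ ^ 2) / 5 := by positivity
  refine (div_le_div_of_nonneg_left (by positivity) hp h).trans (le_of_eq ?_)
  field_simp
  norm_num

theorem cauchyKernel_re (R : ℝ) (x : AddCircle (2 * π)) :
    (cauchyKernel 1 R x).re =
      (1 - R * (fourier 1 x : ℂ).re) / Complex.normSq (1 - R * fourier 1 x) := by
  simp [cauchyKernel, Complex.inv_re]

theorem cauchyKernel_im (R : ℝ) (x : AddCircle (2 * π)) :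
    (cauchyKernel 1 R x).im =
      R * (fourier 1 x : ℂ).im / Complex.normSq (1 - R * fourier 1 x) := by
  simp [cauchyKernel, Complex.inv_im]

theorem cauchyKernel_neg_one (R : ℝ) (x : AddCircle (2 * π)) :
    cauchyKernel (-1) R x = (starRingEnd ℂ) (cauchyKernel 1 R x) := by
  simp only [cauchyKernel, fourier_neg, map_inv₀, map_sub, map_one, map_mul, Complex.conj_ofReal]

theorem poissonKernel_eq_ofReal (R : ℝ) (x : AddCircle (2 * π)) :
    poissonKernel R x = ((2 * (cauchyKernel 1 R x).re - 1 : ℝ) : ℂ) := by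
  rw [poissonKernel, cauchyKernel_neg_one, Complex.add_conj]
  push_cast
  ring

theorem two_mul_cauchyKernel_re_sub_one {R : ℝ} (h0 : 0 ≤ R) (h1 : R < 1)
    (x : AddCircle (2 * π)) : 2 * (cauchyKernel 1 R x).re - 1 =
      (1 - R ^ 2) / Complex.normSq (1 - R * fourier 1 x) := by
  have h : Complex.normSq (1 - R * fourier 1 x) ≠ 0 :=
    (Complex.normSq_pos.2 (one_sub_mul_fourier_ne_zero 1 h0 h1 x)).ne'
  rw [cauchyKernel_re, eq_div_iff h, sub_mul, mul_assoc, div_mul_cancel₀ _ h,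
    normSq_one_sub_mul_fourier]
  ring

theorem half_le_cauchyKernel_re {R : ℝ} (h0 : 0 ≤ R) (h1 : R < 1) (x : AddCircle (2 * π)) :
    1 / 2 ≤ (cauchyKernel 1 R x).re := by
  have h := two_mul_cauchyKernel_re_sub_one h0 h1 x
  have h2 : 0 ≤ (1 - R ^ 2) / Complex.normSq (1 - R * fourier 1 x) :=
    div_nonneg (by nlinarith) (Complex.normSq_nonneg _)
  linarith

theorem norm_poissonKernel_le {δ : ℝ} (h0 : 0 < δ) (h1 : δ ≤ 1 / 2) (x : AddCircle (2 * π)) :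
    ‖poissonKernel (1 - δ) x‖ ≤ 10 * (δ / (δ ^ 2 + ‖x‖ ^ 2)) := by
  refine le_trans ?_ (two_mul_div_normSq_le h0 h1 x)
  rw [poissonKernel_eq_ofReal, Complex.norm_real,
    two_mul_cauchyKernel_re_sub_one (by linarith) (by linarith), Real.norm_of_nonneg
      (div_nonneg (by nlinarith) (Complex.normSq_nonneg _))]
  exact div_le_div_of_nonneg_right (by nlinarith) (Complex.normSq_nonneg _)

/-- The conjugate Poisson kernel of radius `1 - δ` and the Hilbert kernel truncated at `δ` differ
by at most a multiple of the Poisson profile of width `δ`. -/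
theorem abs_cauchyKernel_im_sub_hilbertKernel_le {δ : ℝ} (h0 : 0 < δ) (h1 : δ ≤ 1 / 2)
    (x : AddCircle (2 * π)) :
    |(cauchyKernel 1 (1 - δ) x).im - hilbertKernel δ x| ≤ 10 * (δ / (δ ^ 2 + ‖x‖ ^ 2)) := by
  refine le_trans ?_ (two_mul_div_normSq_le h0 h1 x)
  have hD := Complex.normSq_pos.2
    (one_sub_mul_fourier_ne_zero 1 (R := 1 - δ) (by linarith) (by linarith) x)
  rw [cauchyKernel_im, hilbertKernel]
  have hDe := normSq_one_sub_mul_fourier (1 - δ) x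
  set D := Complex.normSq (1 - ((1 - δ : ℝ) : ℂ) * fourier 1 x)
  have hcs := fourier_one_sq_add_sq x
  have hs := abs_fourier_one_im_le x
  have hu := norm_sq_le_one_sub_fourier_one_re x
  set c := (fourier 1 x : ℂ).re
  set s := (fourier 1 x : ℂ).im
  split_ifs with hx
  · have hxpos : 0 < ‖x‖ := h0.trans_le hx
    have hupos : 0 < 1 - c := lt_of_lt_of_le (by positivity) hu
    have hkey : (1 - δ) * s / D - s / (2 * (1 - c)) = -(s * δ ^ 2) / (2 * (1 - c) * D) := by
      have hc0 : 1 - c ≠ 0 := hupos.ne'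
      field_simp
      rw [hDe]
      ring
    have hsq : (s * δ) ^ 2 ≤ (4 * (1 - c)) ^ 2 := by
      -- `s ^ 2 ≤ 2 (1 - c)` and `δ ^ 2 ≤ ‖x‖ ^ 2 ≤ 5 (1 - c)`
      have h5 : δ ^ 2 ≤ ‖x‖ ^ 2 := pow_le_pow_left₀ h0.le hx 2
      have h6 : (1 : ℝ) / 5 ≤ 2 / π ^ 2 := by
        rw [div_le_div_iff₀ (by norm_num) (by positivity)]
        nlinarith [Real.pi_lt_d2, Real.pi_pos]
      have h7 : δ ^ 2 ≤ 5 * (1 - c) := by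
        have := mul_le_mul_of_nonneg_right h6 (sq_nonneg ‖x‖)
        linarith
      have h8 : s ^ 2 ≤ 2 * (1 - c) := by nlinarith
      calc (s * δ) ^ 2 = s ^ 2 * δ ^ 2 := by ring
        _ ≤ 2 * (1 - c) * (5 * (1 - c)) := mul_le_mul h8 h7 (sq_nonneg _) (by positivity)
        _ ≤ (4 * (1 - c)) ^ 2 := by nlinarith [sq_nonneg (1 - c)]
    have habs : |s * δ| ≤ 4 * (1 - c) := abs_le_of_sq_le_sq hsq (by positivity)
    rw [hkey, abs_div, abs_neg, abs_of_pos (show 0 < 2 * (1 - c) * D by positivity),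
      div_le_div_iff₀ (by positivity) hD]
    have h9 : |s * δ ^ 2| = |s * δ| * δ := by
      rw [pow_two, ← mul_assoc, abs_mul, abs_of_pos h0]
    rw [h9]
    have := mul_le_mul_of_nonneg_right habs h0.le
    nlinarith [mul_le_mul_of_nonneg_right this hD.le]
  · rw [sub_zero, abs_div, abs_of_pos hD, abs_mul, abs_of_nonneg (by linarith : 0 ≤ 1 - δ)]
    refine div_le_div_of_nonneg_right ?_ hD.le
    have : |s| ≤ δ := hs.trans (not_le.1 hx).le
    nlinarith [abs_nonneg s]

theorem measurable_hilbertKernel (δ : ℝ) : Measurable (hilbertKernel δ) := by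
  refine Measurable.ite (measurableSet_le measurable_const measurable_norm) ?_ measurable_const
  have h : Measurable fun x : AddCircle (2 * π) => (fourier 1 x : ℂ) :=
    (fourier 1).continuous.measurable
  exact (Complex.measurable_im.comp h).div
    (((Complex.measurable_re.comp h).const_sub 1).const_mul 2)

theorem fourier_one_neg (x : AddCircle (2 * π)) :
    (fourier 1 (-x) : ℂ) = (starRingEnd ℂ) (fourier 1 x) := by
  rw [← fourier_neg, fourier_apply, fourier_apply, smul_neg, neg_smul]

theorem integral_eq_zero_of_odd {E : Type*} [NormedAddCommGroup E] [NormedSpace ℝ E]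
    {k : AddCircle (2 * π) → E} (hk : ∀ x, k (-x) = -k x) :
    ∫ x, k x ∂haarAddCircle = 0 := by
  have h := integral_neg_eq_self k (haarAddCircle (T := 2 * π))
  simp_rw [hk, integral_neg] at h
  have h2 : (2 : ℝ) • ∫ x, k x ∂haarAddCircle = 0 := by
    rw [two_smul]
    nth_rewrite 1 [← h]
    exact neg_add_cancel _
  exact (smul_eq_zero.1 h2).resolve_left two_ne_zero

theorem integral_cauchyKernel_im_sub_hilbertKernel (R δ : ℝ) :
    ∫ x, (((cauchyKernel 1 R x).im - hilbertKernel δ x : ℝ) : ℂ) ∂haarAddCircle = 0 := by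
  refine integral_eq_zero_of_odd fun x => ?_
  have h1 : cauchyKernel 1 R (-x) = (starRingEnd ℂ) (cauchyKernel 1 R x) := by
    simp only [cauchyKernel, fourier_one_neg, map_inv₀, map_sub, map_one, map_mul,
      Complex.conj_ofReal]
  have h2 : hilbertKernel δ (-x) = -hilbertKernel δ x := by
    simp only [hilbertKernel, norm_neg, fourier_one_neg, Complex.conj_im, Complex.conj_re]
    split_ifs
    · ring
    · simp
  rw [h1, h2, Complex.conj_im]
  push_cast
  ring

theorem integral_cauchyKernel (m : ℤ) (hm : m ≠ 0) {R : ℝ} (h0 : 0 ≤ R) (h1 : R < 1) :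
    ∫ x, cauchyKernel m R x ∂haarAddCircle = 1 := by
  have h := hasSum_integral_cauchyKernel_mul m h0 h1
    (f := fun _ => 1) (integrable_const 1) 0
  simp only [mul_one] at h
  rw [integral_sub_left_eq_self (cauchyKernel m R) haarAddCircle 0] at h
  refine h.unique ?_
  have hc : ∀ k : ℕ, k ≠ 0 → fourierCoeff (fun _ : AddCircle (2 * π) => (1 : ℂ)) (k * m) = 0 := by
    intro k hk
    have h2 := congrFun (fourierCoeff_fourier (T := 2 * π) 0) (k * m)
    rw [Pi.single_eq_of_ne (by positivity)] at h2
    rw [← h2]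
    congr 1
    funext x
    simp
  have h2 := hasSum_single (f := fun k : ℕ => ((R : ℂ) * fourier m (0 : AddCircle (2 * π))) ^ k *
    fourierCoeff (fun _ : AddCircle (2 * π) => (1 : ℂ)) (k * m)) 0
    (fun k hk => by rw [hc k hk, mul_zero])
  simpa [fourierCoeff] using h2

theorem integral_poissonKernel {R : ℝ} (h0 : 0 ≤ R) (h1 : R < 1) :
    ∫ x, poissonKernel R x ∂haarAddCircle = 1 := by
  have hi : ∀ m, Integrable (cauchyKernel m R) haarAddCircle := fun m =>
    (continuous_cauchyKernel m h0 h1).integrable_of_hasCompactSupport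
      (HasCompactSupport.of_compactSpace _)
  simp only [poissonKernel]
  rw [integral_sub (f := fun x => cauchyKernel 1 R x + cauchyKernel (-1) R x)
    ((hi 1).add (hi (-1))) (integrable_const _), integral_add (hi 1) (hi (-1)),
    integral_cauchyKernel 1 one_ne_zero h0 h1, integral_cauchyKernel (-1) (by norm_num) h0 h1]
  simp

end Kernels

end QuantumTrap

namespace QuantumTrap

open AddCircle

/-! ### Boundary values of Poisson and Cauchy integrals -/

section BoundaryValues

variable {f : AddCircle (2 * π) → ℂ} {η : AddCircle (2 * π)}

theorem integrable_kernel_mul (hf : Integrable f haarAddCircle)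
    {k : AddCircle (2 * π) → ℂ} (hk : Measurable k) {C δ : ℝ} (hC : 0 ≤ C) (hδ : 0 < δ)
    (hb : ∀ x, ‖k x‖ ≤ C * (δ / (δ ^ 2 + ‖x‖ ^ 2))) :
    Integrable (fun y => k (η - y) * f y) haarAddCircle := by
  refine hf.bdd_mul (c := C * (1 / δ)) ?_ (Eventually.of_forall fun y => ?_)
  · exact (hk.comp (measurable_const_sub η)).aestronglyMeasurable
  · refine (hb _).trans (mul_le_mul_of_nonneg_left ?_ hC)
    rw [div_le_div_iff₀ (by positivity) hδ]
    nlinarith [sq_nonneg ‖η - y‖]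

theorem tendsto_integral_kernel_mul (hf : Integrable f haarAddCircle)
    (hη : IsLebesguePoint f η) {k : ℝ → AddCircle (2 * π) → ℂ} {C : ℝ} (hC : 0 ≤ C) {c : ℂ}
    (hk : ∀ᶠ δ in 𝓝[>] 0, Measurable (k δ) ∧ (∀ x, ‖k δ x‖ ≤ C * (δ / (δ ^ 2 + ‖x‖ ^ 2))) ∧
      ∫ x, k δ x ∂haarAddCircle = c) :
    Tendsto (fun δ : ℝ => ∫ y, k δ (η - y) * f y ∂haarAddCircle) (𝓝[>] 0) (𝓝 (c * f η)) := by
  have h := tendsto_integral_kernel_mul_sub hf hη (hk.mono fun δ h => h.2.1)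
  have h2 := h.add_const (c * f η)
  rw [zero_add] at h2
  refine h2.congr' ?_
  filter_upwards [hk, self_mem_nhdsWithin] with δ hδ hpos
  obtain ⟨hm, hb, hc⟩ := hδ
  have hi := integrable_kernel_mul (η := η) hf hm hC hpos hb
  have hi2 := integrable_kernel_mul (η := η) (integrable_const (f η)) hm hC hpos hb
  simp_rw [mul_sub]
  rw [integral_sub hi hi2, integral_mul_const, integral_sub_left_eq_self (k δ) haarAddCircle η,
    hc, sub_add_cancel]

theorem eventually_pos_le_half : ∀ᶠ δ in 𝓝[>] (0 : ℝ), 0 < δ ∧ δ ≤ 1 / 2 := by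
  filter_upwards [Ioo_mem_nhdsGT (show (0 : ℝ) < 1 / 2 by norm_num)] with δ hδ
  exact ⟨hδ.1, hδ.2.le⟩

theorem measurable_poissonKernel {R : ℝ} (h0 : 0 ≤ R) (h1 : R < 1) :
    Measurable (poissonKernel R) :=
  (((continuous_cauchyKernel 1 h0 h1).add (continuous_cauchyKernel (-1) h0 h1)).sub
    continuous_const).measurable

/-- Fatou's theorem: the Poisson integral converges radially at Lebesgue points. -/
theorem tendsto_integral_poissonKernel_mul (hf : Integrable f haarAddCircle)
    (hη : IsLebesguePoint f η) :
    Tendsto (fun δ : ℝ => ∫ y, poissonKernel (1 - δ) (η - y) * f y ∂haarAddCircle)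
      (𝓝[>] 0) (𝓝 (f η)) := by
  have h := tendsto_integral_kernel_mul (k := fun δ => poissonKernel (1 - δ)) (C := 10) (c := 1)
    hf hη (by norm_num) ?_
  · simpa only [one_mul] using h
  · filter_upwards [eventually_pos_le_half] with δ ⟨h0, h1⟩
    exact ⟨measurable_poissonKernel (by linarith) (by linarith), norm_poissonKernel_le h0 h1,
      integral_poissonKernel (by linarith) (by linarith)⟩

/-- The conjugate Poisson integral and the truncated Hilbert transform are asymptotic to each
other at Lebesgue points. -/
theorem tendsto_integral_cauchyKernel_im_sub_hilbertKernel (hf : Integrable f haarAddCircle)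
    (hη : IsLebesguePoint f η) :
    Tendsto (fun δ : ℝ => ∫ y, (((cauchyKernel 1 (1 - δ) (η - y)).im -
      hilbertKernel δ (η - y) : ℝ) : ℂ) * f y ∂haarAddCircle) (𝓝[>] 0) (𝓝 0) := by
  have h := tendsto_integral_kernel_mul
    (k := fun δ x => (((cauchyKernel 1 (1 - δ) x).im - hilbertKernel δ x : ℝ) : ℂ))
    (C := 10) (c := 0) hf hη (by norm_num) ?_
  · simpa only [zero_mul] using h
  · filter_upwards [eventually_pos_le_half] with δ ⟨h0, h1⟩
    refine ⟨?_, fun x => ?_, integral_cauchyKernel_im_sub_hilbertKernel _ _⟩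
    · have h2 := (continuous_cauchyKernel 1 (R := 1 - δ) (by linarith) (by linarith)).measurable
      exact Complex.measurable_ofReal.comp
        ((Complex.measurable_im.comp h2).sub (measurable_hilbertKernel δ))
    · rw [Complex.norm_real, Real.norm_eq_abs]
      exact abs_cauchyKernel_im_sub_hilbertKernel_le h0 h1 x

theorem hilbertKernel_coe {t δ : ℝ} (ht : t ∈ Set.Ioc (-π) π) (hδ : 0 < δ) :
    hilbertKernel δ t = if δ ≤ |t| then Real.cot (t / 2) / 2 else 0 := by
  rw [hilbertKernel, norm_coe_of_abs_le (abs_le.2 ⟨ht.1.le, ht.2⟩), fourier_one_re,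
    fourier_one_im]
  split_ifs with h
  · have ht0 : t ≠ 0 := abs_pos.1 (hδ.trans_le h)
    have hs : Real.sin (t / 2) ≠ 0 := by
      intro h0
      have h1 := (Real.sin_eq_zero_iff_of_lt_of_lt (by linarith [ht.1, Real.pi_pos])
        (by linarith [ht.2, Real.pi_pos])).1 h0
      exact ht0 (by linarith)
    have h1 : Real.sin t = 2 * Real.sin (t / 2) * Real.cos (t / 2) := by
      rw [← Real.sin_two_mul]; ring_nf
    have h2 : 1 - Real.cos t = 2 * Real.sin (t / 2) ^ 2 := by
      have := Real.cos_two_mul (t / 2)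
      rw [show 2 * (t / 2) = t by ring] at this
      rw [this, Real.cos_sq']
      ring
    rw [h1, h2, Real.cot_eq_cos_div_sin]
    field_simp
  · rfl

theorem truncatedHilbert_eq (ρ : AddCircle (2 * π) → ℝ) (η : AddCircle (2 * π)) {δ : ℝ}
    (hδ : 0 < δ) :
    truncatedHilbert ρ η δ = ∫ y, hilbertKernel δ (η - y) * ρ y ∂haarAddCircle := by
  have h1 := integral_sub_left_eq_self (fun y => hilbertKernel δ y * ρ (η - y))
    (haarAddCircle (T := 2 * π)) η
  simp only [sub_sub_cancel] at h1
  rw [h1, integral_haarAddCircle, ← AddCircle.integral_preimage (2 * π) (-π),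
    show -π + 2 * π = π by ring, truncatedHilbert]
  have hs : MeasurableSet {x : ℝ | δ ≤ |x|} := measurableSet_le measurable_const measurable_abs
  have hset : {x : ℝ | x ∈ Set.Ioc (-π) π ∧ δ ≤ |x|} = {x | δ ≤ |x|} ∩ Set.Ioc (-π) π := by
    ext x; exact and_comm
  rw [hset, ← Measure.restrict_restrict hs, ← integral_indicator hs, smul_eq_mul,
    show 1 / (4 * π) = (2 * π)⁻¹ * (1 / 2) by field_simp; norm_num, mul_assoc,
    ← integral_const_mul]
  congr 1
  refine setIntegral_congr_fun measurableSet_Ioc fun t ht => ?_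
  rw [hilbertKernel_coe ht hδ]
  by_cases h : δ ≤ |t|
  · rw [Set.indicator_of_mem (show t ∈ {x : ℝ | δ ≤ |x|} from h), if_pos h]
    ring
  · rw [Set.indicator_of_notMem (show t ∉ {x : ℝ | δ ≤ |x|} from h), if_neg h]
    ring

/-- Riesz–Fischer for sequences supported on `ℕ`. -/
theorem exists_memLp_fourierCoeff {b : ℕ → ℂ} (hb : Summable fun k => ‖b k‖ ^ 2) :
    ∃ g : AddCircle (2 * π) → ℂ, MemLp g 2 haarAddCircle ∧
      (∀ k : ℕ, fourierCoeff g k = b k) ∧ (∀ k : ℕ, k ≠ 0 → fourierCoeff g (-k) = 0) ∧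
      ∫ y, ‖g y‖ ^ 2 ∂haarAddCircle = ∑' k, ‖b k‖ ^ 2 := by
  have hinj : Function.Injective ((↑) : ℕ → ℤ) := Nat.cast_injective
  set β : ℤ → ℂ := Function.extend ((↑) : ℕ → ℤ) b 0 with hβ
  have hβn : ∀ k : ℕ, β k = b k := fun k => hinj.extend_apply b 0 k
  have hβ0 : ∀ n : ℤ, n ∉ Set.range ((↑) : ℕ → ℤ) → β n = 0 := fun n hn =>
    Function.extend_apply' _ _ _ hn
  have hsum : HasSum (fun n => ‖β n‖ ^ 2) (∑' k, ‖b k‖ ^ 2) := by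
    rw [← hinj.hasSum_iff]
    · simpa only [Function.comp_def, hβn] using hb.hasSum
    · intro n hn
      simp [hβ0 n hn]
  have hmem : Memℓp β 2 := by
    refine memℓp_gen ?_
    simpa using hsum.summable
  set g := (fourierBasis (T := 2 * π)).repr.symm ⟨β, hmem⟩ with hg
  have hgc : ∀ n, fourierCoeff g n = β n := by
    intro n
    rw [← fourierBasis_repr, hg, LinearIsometryEquiv.apply_symm_apply]
  refine ⟨g, Lp.memLp g, fun k => by rw [hgc, hβn], fun k hk => ?_, ?_⟩
  · rw [hgc, hβ0]
    rintro ⟨j, hj⟩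
    omega
  · have h := hasSum_sq_fourierCoeff g
    simp_rw [hgc] at h
    exact h.unique hsum

/-- Radial limits of a power series with square summable coefficients. -/
theorem tendsto_tsum_radial {b : ℕ → ℂ} (hf : Integrable f haarAddCircle)
    (hb : ∀ k : ℕ, fourierCoeff f k = b k) (hb' : ∀ k : ℕ, k ≠ 0 → fourierCoeff f (-k) = 0)
    (hη : IsLebesguePoint f η) :
    Tendsto (fun δ : ℝ => ∑' k : ℕ, b k * (((1 - δ : ℝ) : ℂ) * fourier 1 η) ^ k)
      (𝓝[>] 0) (𝓝 (f η)) := by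
  refine (tendsto_integral_poissonKernel_mul hf hη).congr' ?_
  filter_upwards [eventually_pos_le_half] with δ ⟨h0, h1⟩
  have hR0 : 0 ≤ 1 - δ := by linarith
  have hR1 : 1 - δ < 1 := by linarith
  have hi : ∀ m, Integrable (fun y => cauchyKernel m (1 - δ) (η - y) * f y) haarAddCircle := by
    intro m
    have hc := continuous_cauchyKernel m hR0 hR1
    obtain ⟨M, hM⟩ := (isCompact_range hc).isBounded.exists_norm_le
    exact hf.bdd_mul (c := M) (hc.comp (by fun_prop)).aestronglyMeasurable
      (Eventually.of_forall fun y => hM _ (Set.mem_range_self _))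
  have hs1 := (hasSum_integral_cauchyKernel_mul 1 hR0 hR1 hf η).tsum_eq
  have hs2 := (hasSum_integral_cauchyKernel_mul (-1) hR0 hR1 hf η)
  -- only the constant term of the conjugate series survives
  have hs3 := hs2.unique (hasSum_single 0 fun k hk => by
    rw [mul_neg_one, hb' k hk, mul_zero])
  have hf0 : ∫ y, f y ∂haarAddCircle = fourierCoeff f 0 := by simp [fourierCoeff]
  simp only [poissonKernel, sub_mul, add_mul, one_mul]
  rw [integral_sub (f := fun y => cauchyKernel 1 (1 - δ) (η - y) * f y +
      cauchyKernel (-1) (1 - δ) (η - y) * f y) ((hi 1).add (hi (-1))) hf,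
    integral_add (hi 1) (hi (-1)), hs3, hf0, ← hs1]
  simp [hb, mul_comm]

/-- The mean value property, on the circle group. -/
theorem integral_comp_mul_fourier_one {F : ℂ → ℂ} {R : ℝ} (hR : 0 ≤ R)
    (hF : DiffContOnCl ℂ F (Metric.ball 0 R)) :
    ∫ x : AddCircle (2 * π), F (R * fourier 1 x) ∂haarAddCircle = F 0 := by
  have h := DiffContOnCl.circleAverage (f := F) (c := 0) (R := R) (by rwa [abs_of_nonneg hR])
  rw [Real.circleAverage, intervalIntegral.integral_of_le Real.two_pi_pos.le] at h
  rw [← h, integral_haarAddCircle, ← AddCircle.integral_preimage (2 * π) 0, zero_add]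
  congr 1
  refine setIntegral_congr_fun measurableSet_Ioc fun t _ => ?_
  simp only [fourier_one_coe, circleMap_zero]

/-- The boundary values of an analytic function with nonnegative real part that is not zero at the
origin vanish almost nowhere.  By the mean value property `∫ 1 / (ε + g) = 1 / (ε + 1) ≤ 1`, while
the real part of the integrand is nonnegative and equal to `1 / ε` on `{g = 0}`; hence this set
has measure at most `ε`. -/
theorem ae_ne_zero_of_radial_limit {F : ℂ → ℂ} (hF : DifferentiableOn ℂ F (Metric.ball 0 1))
    (hre : ∀ z ∈ Metric.ball (0 : ℂ) 1, 0 ≤ (F z).re) (hF0 : F 0 = 1)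
    {g : AddCircle (2 * π) → ℂ}
    (hlim : ∀ᵐ x ∂(haarAddCircle (T := 2 * π)),
      Tendsto (fun δ : ℝ => F (((1 - δ : ℝ) : ℂ) * fourier 1 x)) (𝓝[>] 0) (𝓝 (g x))) :
    ∀ᵐ x ∂(haarAddCircle (T := 2 * π)), g x ≠ 0 := by
  have hball : ∀ δ : ℝ, 0 < δ ∧ δ ≤ 1 / 2 → ∀ x : AddCircle (2 * π),
      ((1 - δ : ℝ) : ℂ) * fourier 1 x ∈ Metric.ball (0 : ℂ) 1 := by
    intro δ hδ x
    rw [mem_ball_zero_iff, norm_mul, fourier_apply, Circle.norm_coe, mul_one, Complex.norm_real,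
      Real.norm_of_nonneg (by linarith [hδ.2])]
    linarith [hδ.1]
  have hgre : ∀ᵐ x ∂(haarAddCircle (T := 2 * π)), 0 ≤ (g x).re := by
    filter_upwards [hlim] with x hx
    refine ge_of_tendsto ((Complex.continuous_re.tendsto _).comp hx) ?_
    filter_upwards [eventually_pos_le_half] with δ hδ
    exact hre _ (hball δ hδ x)
  have hinv : ∀ ε : ℝ, 0 < ε → ∀ w : ℂ, 0 ≤ w.re → (ε : ℂ) + w ≠ 0 ∧ ‖((ε : ℂ) + w)⁻¹‖ ≤ ε⁻¹ := by
    intro ε hε w hw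
    have h1 : ε ≤ ‖(ε : ℂ) + w‖ := by
      refine le_trans ?_ (Complex.re_le_norm _)
      simpa using hw
    refine ⟨norm_pos_iff.1 (hε.trans_le h1), ?_⟩
    rw [norm_inv]
    exact inv_anti₀ hε h1
  have key : ∀ ε : ℝ, 0 < ε →
      (haarAddCircle (T := 2 * π)).real {x | g x = 0} ≤ ε := by
    intro ε hε
    have hcont : ∀ δ : ℝ, 0 < δ ∧ δ ≤ 1 / 2 → Continuous fun x : AddCircle (2 * π) =>
        ((ε : ℂ) + F (((1 - δ : ℝ) : ℂ) * fourier 1 x))⁻¹ := by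
      intro δ hδ
      refine Continuous.inv₀ (continuous_const.add (hF.continuousOn.comp_continuous (by fun_prop)
        (hball δ hδ))) fun x => (hinv ε hε _ (hre _ (hball δ hδ x))).1
    have hmean : ∀ δ : ℝ, 0 < δ ∧ δ ≤ 1 / 2 →
        ∫ x : AddCircle (2 * π), ((ε : ℂ) + F (((1 - δ : ℝ) : ℂ) * fourier 1 x))⁻¹
          ∂haarAddCircle = ((ε : ℂ) + 1)⁻¹ := by
      intro δ hδ
      rw [integral_comp_mul_fourier_one (F := fun z => ((ε : ℂ) + F z)⁻¹) (by linarith [hδ.2]),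
        hF0]
      refine DifferentiableOn.diffContOnCl (DifferentiableOn.mono (t := Metric.ball 0 1) ?_ ?_)
      · exact (hF.const_add _).fun_inv fun z hz => (hinv ε hε _ (hre z hz)).1
      · refine Metric.closure_ball_subset_closedBall.trans
          (Metric.closedBall_subset_ball (by linarith [hδ.1]))
    have hlimε : ∀ᵐ x ∂(haarAddCircle (T := 2 * π)), Tendsto (fun δ : ℝ =>
        ((ε : ℂ) + F (((1 - δ : ℝ) : ℂ) * fourier 1 x))⁻¹) (𝓝[>] 0) (𝓝 ((ε + g x)⁻¹)) := by
      filter_upwards [hlim, hgre] with x hx hx'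
      exact (hx.const_add _).inv₀ (hinv ε hε _ hx').1
    have hDCT := tendsto_integral_filter_of_dominated_convergence
      (μ := haarAddCircle (T := 2 * π)) (l := 𝓝[>] (0 : ℝ)) (fun _ => ε⁻¹) ?_ ?_
      (integrable_const _) hlimε
    · have hint : ∫ x, ((ε : ℂ) + g x)⁻¹ ∂haarAddCircle = ((ε : ℂ) + 1)⁻¹ := by
        refine tendsto_nhds_unique hDCT (tendsto_const_nhds.congr' ?_)
        filter_upwards [eventually_pos_le_half] with δ hδ
        exact (hmean δ hδ).symm
      have hne : ((ε : ℂ) + 1)⁻¹ ≠ 0 := inv_ne_zero (by exact_mod_cast (by positivity : ε + 1 ≠ 0))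
      have hI : Integrable (fun x => ((ε : ℂ) + g x)⁻¹) haarAddCircle := by
        by_contra hn
        rw [integral_undef hn] at hint
        exact hne hint.symm
      have hre2 : ∫ x, (((ε : ℂ) + g x)⁻¹).re ∂haarAddCircle = (ε + 1)⁻¹ := by
        have h1 : ∫ x, (((ε : ℂ) + g x)⁻¹).re ∂haarAddCircle =
          (∫ x, ((ε : ℂ) + g x)⁻¹ ∂haarAddCircle).re := integral_re hI
        rw [h1, hint]
        norm_cast
      have hnn : 0 ≤ᵐ[haarAddCircle] fun x => (((ε : ℂ) + g x)⁻¹).re := by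
        filter_upwards [hgre] with x hx
        rw [Complex.inv_re]
        refine div_nonneg ?_ (Complex.normSq_nonneg _)
        simpa using add_nonneg hε.le hx
      have hM := mul_meas_ge_le_integral_of_nonneg hnn hI.re ε⁻¹
      rw [hre2] at hM
      have hsub : {x | g x = 0} ⊆ {x | ε⁻¹ ≤ (((ε : ℂ) + g x)⁻¹).re} := by
        intro x hx
        rw [Set.mem_ofPred_eq] at hx ⊢
        rw [hx, add_zero, ← Complex.ofReal_inv, Complex.ofReal_re]
      have h2 : ε⁻¹ * (haarAddCircle (T := 2 * π)).real {x | g x = 0} ≤ 1 :=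
        ((mul_le_mul_of_nonneg_left (measureReal_mono hsub) (inv_nonneg.2 hε.le)).trans hM).trans
          (inv_le_one_of_one_le₀ (by linarith))
      rw [inv_mul_le_iff₀ hε, mul_one] at h2
      exact h2
    · filter_upwards [eventually_pos_le_half] with δ hδ
      exact (hcont δ hδ).aestronglyMeasurable
    · filter_upwards [eventually_pos_le_half] with δ hδ
      exact Eventually.of_forall fun x => (hinv ε hε _ (hre _ (hball δ hδ x))).2
  have h0 : (haarAddCircle (T := 2 * π)).real {x | g x = 0} = 0 :=
    le_antisymm (le_of_forall_pos_le_add fun ε hε => by simpa using key ε hε) measureReal_nonneg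
  rw [measureReal_eq_zero_iff] at h0
  rw [ae_iff]
  simpa using h0

end BoundaryValues

end QuantumTrap

namespace QuantumTrap

open AddCircle

/-! ### Power series on the disc and the Cauchy transform -/

section PowerSeries

theorem summable_norm_mul_pow {a : ℕ → ℂ} {M : ℝ} (ha : ∀ k, ‖a k‖ ≤ M) {z : ℂ} (hz : ‖z‖ < 1) :
    Summable fun k => ‖a k * z ^ k‖ := by
  refine Summable.of_nonneg_of_le (fun _ => norm_nonneg _) (fun k => ?_)
    ((summable_geometric_of_lt_one (norm_nonneg z) hz).mul_left M)
  rw [norm_mul, norm_pow]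
  exact mul_le_mul_of_nonneg_right (ha k) (by positivity)

theorem differentiableOn_tsum_mul_pow {a : ℕ → ℂ} {M : ℝ} (ha : ∀ k, ‖a k‖ ≤ M) :
    DifferentiableOn ℂ (fun z => ∑' k, a k * z ^ k) (Metric.ball 0 1) := by
  intro z hz
  rw [mem_ball_zero_iff] at hz
  have h1 : (1 + ‖z‖) / 2 < 1 := by linarith
  have h := Complex.differentiableOn_tsum_of_summable_norm (F := fun k z => a k * z ^ k)
    (U := Metric.ball (0 : ℂ) ((1 + ‖z‖) / 2))
    ((summable_geometric_of_lt_one (by positivity) h1).mul_left M) (fun k => by fun_prop)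
    Metric.isOpen_ball (fun k w hw => by
      rw [mem_ball_zero_iff] at hw
      rw [norm_mul, norm_pow]
      exact mul_le_mul (ha k) (pow_le_pow_left₀ (norm_nonneg _) hw.le _) (by positivity)
        ((norm_nonneg _).trans (ha 0)))
  exact (h.differentiableAt (Metric.isOpen_ball.mem_nhds (by
    rw [mem_ball_zero_iff]; linarith))).differentiableWithinAt

theorem tsum_mul_tsum_eq_one {a b : ℕ → ℂ} {A B : ℝ} (ha : ∀ k, ‖a k‖ ≤ A) (hb : ∀ k, ‖b k‖ ≤ B)
    (hab : ∀ n, ∑ j ∈ Finset.range (n + 1), a j * b (n - j) = if n = 0 then 1 else 0)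
    {z : ℂ} (hz : ‖z‖ < 1) : (∑' k, a k * z ^ k) * ∑' k, b k * z ^ k = 1 := by
  rw [tsum_mul_tsum_eq_tsum_sum_range_of_summable_norm (summable_norm_mul_pow ha hz)
    (summable_norm_mul_pow hb hz)]
  have h : ∀ n, ∑ j ∈ Finset.range (n + 1), a j * z ^ j * (b (n - j) * z ^ (n - j)) =
      if n = 0 then 1 else 0 := by
    intro n
    calc ∑ j ∈ Finset.range (n + 1), a j * z ^ j * (b (n - j) * z ^ (n - j))
        = ∑ j ∈ Finset.range (n + 1), a j * b (n - j) * z ^ n := by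
          refine Finset.sum_congr rfl fun j hj => ?_
          rw [← Nat.add_sub_cancel' (Nat.lt_succ_iff.1 (Finset.mem_range.1 hj)), pow_add,
            Nat.add_sub_cancel_left]
          ring
      _ = if n = 0 then 1 else 0 := by
          rw [← Finset.sum_mul, hab]
          split_ifs with h0
          · rw [h0, pow_zero, mul_one]
          · rw [zero_mul]
  simp_rw [h]
  exact tsum_ite_eq 0 _

theorem exists_eq_norm_mul_fourier_one (z : ℂ) :
    ∃ x : AddCircle (2 * π), z = (‖z‖ : ℂ) * fourier 1 x :=
  ⟨(Complex.arg z : ℝ), by rw [fourier_one_coe, Complex.norm_mul_exp_arg_mul_I]⟩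

end PowerSeries

section CauchyTransform

variable {ρ : AddCircle (2 * π) → ℝ}

theorem integrable_cauchyKernel_mul (hρ : Integrable ρ haarAddCircle) (m : ℤ) {R : ℝ} (h0 : 0 ≤ R)
    (h1 : R < 1) (η : AddCircle (2 * π)) :
    Integrable (fun y => cauchyKernel m R (η - y) * (ρ y : ℂ)) haarAddCircle := by
  have hc := continuous_cauchyKernel m h0 h1
  obtain ⟨M, hM⟩ := (isCompact_range hc).isBounded.exists_norm_le
  exact hρ.ofReal.bdd_mul (c := M) (hc.comp (by fun_prop)).aestronglyMeasurable
    (Eventually.of_forall fun y => hM _ (Set.mem_range_self _))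

theorem cauchyTransform_re (hρ : Integrable ρ haarAddCircle) {R : ℝ} (h0 : 0 ≤ R)
    (h1 : R < 1) (η : AddCircle (2 * π)) :
    (∫ y, cauchyKernel 1 R (η - y) * (ρ y : ℂ) ∂haarAddCircle).re =
      ∫ y, (cauchyKernel 1 R (η - y)).re * ρ y ∂haarAddCircle := by
  have h := integral_re (𝕜 := ℂ) (integrable_cauchyKernel_mul hρ 1 h0 h1 η)
  refine h.symm.trans (integral_congr_ae (Eventually.of_forall fun y => ?_))
  exact Complex.re_mul_ofReal _ _

theorem cauchyTransform_im (hρ : Integrable ρ haarAddCircle) {R : ℝ} (h0 : 0 ≤ R)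
    (h1 : R < 1) (η : AddCircle (2 * π)) :
    (∫ y, cauchyKernel 1 R (η - y) * (ρ y : ℂ) ∂haarAddCircle).im =
      ∫ y, (cauchyKernel 1 R (η - y)).im * ρ y ∂haarAddCircle := by
  have h := integral_im (𝕜 := ℂ) (integrable_cauchyKernel_mul hρ 1 h0 h1 η)
  refine h.symm.trans (integral_congr_ae (Eventually.of_forall fun y => ?_))
  exact Complex.im_mul_ofReal _ _

theorem integrable_cauchyKernel_re_mul (hρ : Integrable ρ haarAddCircle) {R : ℝ} (h0 : 0 ≤ R)
    (h1 : R < 1) (η : AddCircle (2 * π)) :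
    Integrable (fun y => (cauchyKernel 1 R (η - y)).re * ρ y) haarAddCircle := by
  refine (integrable_cauchyKernel_mul hρ 1 h0 h1 η).re.congr (Eventually.of_forall fun y => ?_)
  exact Complex.re_mul_ofReal _ _

theorem integrable_cauchyKernel_im_mul (hρ : Integrable ρ haarAddCircle) {R : ℝ} (h0 : 0 ≤ R)
    (h1 : R < 1) (η : AddCircle (2 * π)) :
    Integrable (fun y => (cauchyKernel 1 R (η - y)).im * ρ y) haarAddCircle := by
  refine (integrable_cauchyKernel_mul hρ 1 h0 h1 η).im.congr (Eventually.of_forall fun y => ?_)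
  exact Complex.im_mul_ofReal _ _

theorem integrable_hilbertKernel_mul (hρ : Integrable ρ haarAddCircle) {δ : ℝ} (h0 : 0 < δ)
    (h1 : δ ≤ 1 / 2) (η : AddCircle (2 * π)) :
    Integrable (fun y => hilbertKernel δ (η - y) * ρ y) haarAddCircle := by
  have hm : Measurable fun x =>
      (((cauchyKernel 1 (1 - δ) x).im - hilbertKernel δ x : ℝ) : ℂ) :=
    Complex.measurable_ofReal.comp ((Complex.measurable_im.comp
      (continuous_cauchyKernel 1 (R := 1 - δ) (by linarith) (by linarith)).measurable).sub
        (measurable_hilbertKernel δ))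
  have h2 := (integrable_kernel_mul (η := η) hρ.ofReal hm (C := 10) (by norm_num) h0 fun x => by
    rw [Complex.norm_real, Real.norm_eq_abs]
    exact abs_cauchyKernel_im_sub_hilbertKernel_le h0 h1 x).re
  refine ((integrable_cauchyKernel_im_mul hρ (R := 1 - δ) (by linarith) (by linarith) η).sub
    h2).congr (Eventually.of_forall fun y => ?_)
  simp only [Pi.sub_apply]
  change _ - (((_ : ℝ) : ℂ) * (ρ y : ℂ)).re = _
  rw [Complex.re_mul_ofReal, Complex.ofReal_re]
  ring

theorem tendsto_cauchyTransform_re (hρ : Integrable ρ haarAddCircle) {η : AddCircle (2 * π)}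
    (hη : IsLebesguePoint (fun y => (ρ y : ℂ)) η) :
    Tendsto (fun δ : ℝ => (∫ y, cauchyKernel 1 (1 - δ) (η - y) * (ρ y : ℂ) ∂haarAddCircle).re)
      (𝓝[>] 0) (𝓝 ((∫ y, ρ y ∂haarAddCircle + ρ η) / 2)) := by
  have h := (Complex.continuous_re.tendsto _).comp
    (tendsto_integral_poissonKernel_mul hρ.ofReal hη)
  refine ((h.const_add (∫ y, ρ y ∂haarAddCircle)).div_const 2).congr' ?_
  filter_upwards [eventually_pos_le_half] with δ ⟨h0, h1⟩
  have hR0 : 0 ≤ 1 - δ := by linarith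
  have hR1 : 1 - δ < 1 := by linarith
  have h2 : ∫ y, poissonKernel (1 - δ) (η - y) * (ρ y : ℂ) ∂haarAddCircle =
      ((∫ y, (2 * ((cauchyKernel 1 (1 - δ) (η - y)).re * ρ y) - ρ y) ∂haarAddCircle : ℝ) : ℂ) := by
    rw [← integral_complex_ofReal]
    refine integral_congr_ae (Eventually.of_forall fun y => ?_)
    simp only [poissonKernel_eq_ofReal]
    push_cast
    ring
  rw [Function.comp_apply]
  simp only [RCLike.ofReal_eq_complex_ofReal]
  rw [h2, Complex.ofReal_re, integral_sub
    ((integrable_cauchyKernel_re_mul hρ hR0 hR1 η).const_mul 2) hρ, integral_const_mul,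
    cauchyTransform_re hρ hR0 hR1]
  ring

theorem tendsto_cauchyTransform_im_sub_truncatedHilbert (hρ : Integrable ρ haarAddCircle)
    {η : AddCircle (2 * π)} (hη : IsLebesguePoint (fun y => (ρ y : ℂ)) η) :
    Tendsto (fun δ : ℝ => (∫ y, cauchyKernel 1 (1 - δ) (η - y) * (ρ y : ℂ) ∂haarAddCircle).im -
      truncatedHilbert ρ η δ) (𝓝[>] 0) (𝓝 0) := by
  have h := (Complex.continuous_re.tendsto _).comp
    (tendsto_integral_cauchyKernel_im_sub_hilbertKernel hρ.ofReal hη)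
  rw [Complex.zero_re] at h
  refine h.congr' ?_
  filter_upwards [eventually_pos_le_half] with δ ⟨h0, h1⟩
  have hR0 : 0 ≤ 1 - δ := by linarith
  have hR1 : 1 - δ < 1 := by linarith
  rw [Function.comp_apply, cauchyTransform_im hρ hR0 hR1, truncatedHilbert_eq ρ η h0,
    ← integral_sub (integrable_cauchyKernel_im_mul hρ hR0 hR1 η)
      (integrable_hilbertKernel_mul hρ h0 h1 η)]
  rw [← Complex.ofReal_re (∫ _, _ ∂_), ← integral_complex_ofReal]
  congr 1
  refine integral_congr_ae (Eventually.of_forall fun y => ?_)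
  simp only
  push_cast
  rw [sub_mul]
  rfl

end CauchyTransform

end QuantumTrap

namespace QuantumTrap

open AddCircle

/-! ### The spectral density and the boundary value of the survival series -/

section SpectralDensity

theorem integrable_density (μ : Measure (AddCircle (2 * π))) [IsFiniteMeasure μ] :
    Integrable (density μ) haarAddCircle :=
  Measure.integrable_toReal_rnDeriv

theorem density_nonneg (μ : Measure (AddCircle (2 * π))) (θ : AddCircle (2 * π)) :
    0 ≤ density μ θ :=
  ENNReal.toReal_nonneg

variable {H : Type*} [NormedAddCommGroup H] [InnerProductSpace ℂ H] [CompleteSpace H]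
  {U : unitary (H →L[ℂ] H)} {E : ProjectionValuedMeasure (AddCircle (2 * π)) H} {φ : H}

theorem integral_density (hφ : ‖φ‖ = 1) (hac : E.measureAt φ ≪ haarAddCircle) :
    ∫ y, density (E.measureAt φ) y ∂haarAddCircle = 1 := by
  have h := Measure.integral_toReal_rnDeriv hac
  rw [E.measureAt_real φ MeasurableSet.univ, E.proj_univ, one_apply_eq_self, hφ, one_pow] at h
  exact h

/-- The return amplitudes are the Fourier coefficients of the spectral density. -/
theorem fourierCoeff_density (hE : IsSpectralMeasure U E) (hac : E.measureAt φ ≪ haarAddCircle)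
    (k : ℕ) :
    fourierCoeff (fun y => (density (E.measureAt φ) y : ℂ)) k = returnAmp U φ k := by
  have hcont : Continuous fun θ : AddCircle (2 * π) => ((-θ).toCircle : ℂ) := by fun_prop
  rw [returnAmp, inner_pow_eq_integral E hcont.measurable (M := 1)
    (fun θ => (Circle.norm_coe _).le) hE φ k, ← integral_rnDeriv_smul hac, fourierCoeff]
  refine integral_congr_ae (Eventually.of_forall fun θ => ?_)
  have h : ((-θ).toCircle : ℂ) = fourier (-1) θ := by simp [fourier_apply]
  simp only
  rw [h, fourier_pow, mul_neg_one, smul_eq_mul, mul_comm, Complex.real_smul]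
  rfl

/-- Almost everywhere, the survival series `∑ b_k z ^ k = 1 / r (z)` has a radial limit `g η`, which
is the inverse of `(1 + ρ) / 2 + i 𝓗ρ`.  In particular the Hilbert transform exists. -/
theorem exists_boundary_value (hE : IsSpectralMeasure U E) (hφ : ‖φ‖ = 1)
    (hac : E.measureAt φ ≪ haarAddCircle) :
    ∃ g : AddCircle (2 * π) → ℂ, MemLp g 2 haarAddCircle ∧
      ∫ y, g y ∂haarAddCircle = 1 ∧
      ∫ y, ‖g y‖ ^ 2 ∂haarAddCircle = ∑' k, ‖survivalCoeff U φ k‖ ^ 2 ∧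
      ∀ᵐ η : AddCircle (2 * π),
        Tendsto (truncatedHilbert (density (E.measureAt φ)) η) (𝓝[>] 0)
          (𝓝 (hilbertTransform (density (E.measureAt φ)) η)) ∧
        g η ≠ 0 ∧ (g η)⁻¹ = ⟨(1 + density (E.measureAt φ) η) / 2,
          hilbertTransform (density (E.measureAt φ)) η⟩ := by
  obtain ⟨g, hg2, hgb, hgb', hgn⟩ :=
    exists_memLp_fourierCoeff (summable_norm_sq_survivalCoeff U hφ)
  have hgi : Integrable g haarAddCircle := hg2.integrable (by norm_num)
  set ρ := density (E.measureAt φ) with hρdef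
  have hρ : Integrable ρ haarAddCircle := integrable_density _
  have hρ1 : ∫ y, ρ y ∂haarAddCircle = 1 := integral_density hφ hac
  have hr : ∀ {R : ℝ}, 0 ≤ R → R < 1 → ∀ η : AddCircle (2 * π),
      ∑' k, returnAmp U φ k * ((R : ℂ) * fourier 1 η) ^ k =
        ∫ y, cauchyKernel 1 R (η - y) * (ρ y : ℂ) ∂haarAddCircle := by
    intro R h0 h1 η
    refine Eq.trans ?_ (hasSum_integral_cauchyKernel_mul 1 h0 h1 hρ.ofReal η).tsum_eq
    refine tsum_congr fun k => ?_
    rw [mul_comm, mul_one, ← fourierCoeff_density hE hac]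
    rfl
  have hbr : ∀ {z : ℂ}, ‖z‖ < 1 →
      (∑' k, survivalCoeff U φ k * z ^ k) * ∑' k, returnAmp U φ k * z ^ k = 1 := fun hz =>
    tsum_mul_tsum_eq_one (norm_survivalCoeff_le U hφ) (norm_returnAmp_le U hφ)
      (sum_survivalCoeff_mul_returnAmp U hφ) hz
  -- the Cauchy kernel has real part at least `1 / 2`, so `r` and `1 / r` have positive real part
  have hre : ∀ z ∈ Metric.ball (0 : ℂ) 1, 0 ≤ (∑' k, survivalCoeff U φ k * z ^ k).re := by
    intro z hz
    rw [mem_ball_zero_iff] at hz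
    rw [eq_inv_of_mul_eq_one_left (hbr hz), Complex.inv_re]
    refine div_nonneg ?_ (Complex.normSq_nonneg _)
    obtain ⟨η, hη⟩ := exists_eq_norm_mul_fourier_one z
    rw [hη, hr (norm_nonneg z) hz, cauchyTransform_re hρ (norm_nonneg z) hz]
    exact integral_nonneg fun y => mul_nonneg (le_trans (by norm_num)
      (half_le_cauchyKernel_re (norm_nonneg z) hz _)) (density_nonneg _ _)
  have hlebg := ae_isLebesguePoint hgi
  have hlebρ := ae_isLebesguePoint hρ.ofReal
  have hne : ∀ᵐ η : AddCircle (2 * π), g η ≠ 0 := by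
    refine absolutelyContinuous_volume_haarAddCircle.ae_le (ae_ne_zero_of_radial_limit
      (differentiableOn_tsum_mul_pow (norm_survivalCoeff_le U hφ)) hre ?_ ?_)
    · rw [tsum_eq_single 0 fun k hk => by rw [zero_pow hk, mul_zero]]
      simp [survivalCoeff]
    · filter_upwards [absolutelyContinuous_haarAddCircle_volume.ae_le hlebg] with η hη
      exact tendsto_tsum_radial hgi hgb hgb' hη
  refine ⟨g, hg2, ?_, hgn, ?_⟩
  · have h := hgb 0
    simpa [fourierCoeff, survivalCoeff] using h
  filter_upwards [hlebg, hlebρ, hne] with η h1 h2 h3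
  have hlim : Tendsto (fun δ : ℝ => ∫ y, cauchyKernel 1 (1 - δ) (η - y) * (ρ y : ℂ)
      ∂haarAddCircle) (𝓝[>] 0) (𝓝 (g η)⁻¹) := by
    refine ((tendsto_tsum_radial hgi hgb hgb' h1).inv₀ h3).congr' ?_
    filter_upwards [eventually_pos_le_half] with δ ⟨h0, h4⟩
    have hR0 : 0 ≤ 1 - δ := by linarith
    have hR1 : 1 - δ < 1 := by linarith
    rw [← hr hR0 hR1]
    refine inv_eq_iff_eq_inv.2 (eq_inv_of_mul_eq_one_left (hbr ?_))
    rwa [norm_mul, fourier_apply, Circle.norm_coe, mul_one, Complex.norm_real,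
      Real.norm_of_nonneg hR0]
  have hreal : ((g η)⁻¹).re = (1 + ρ η) / 2 := by
    refine tendsto_nhds_unique ((Complex.continuous_re.tendsto _).comp hlim) ?_
    have h5 := tendsto_cauchyTransform_re hρ h2
    rw [hρ1] at h5
    exact h5
  have him : Tendsto (truncatedHilbert ρ η) (𝓝[>] 0) (𝓝 ((g η)⁻¹).im) := by
    have h5 := ((Complex.continuous_im.tendsto _).comp hlim).sub
      (tendsto_cauchyTransform_im_sub_truncatedHilbert hρ h2)
    rw [sub_zero] at h5
    refine h5.congr fun δ => ?_
    rw [Function.comp_apply, sub_sub_cancel]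
  have hH : hilbertTransform ρ η = ((g η)⁻¹).im := him.limUnder_eq
  exact ⟨by rw [hH]; exact him, h3, Complex.ext hreal hH.symm⟩

end SpectralDensity

end QuantumTrap

/-! ### The asymptotic current -/

theorem theorem1 {H : Type*} [NormedAddCommGroup H] [InnerProductSpace ℂ H] [CompleteSpace H]
    (U : unitary (H →L[ℂ] H)) (E : ProjectionValuedMeasure (AddCircle (2 * π)) H)
    (hE : IsSpectralMeasure U E) (φ : H) (hφ : ‖φ‖ = 1)
    (hac : E.measureAt φ ≪ (volume : Measure (AddCircle (2 * π)))) :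
    (∀ᵐ η : AddCircle (2 * π),
      Tendsto (truncatedHilbert (density (E.measureAt φ)) η) (𝓝[>] 0)
        (𝓝 (hilbertTransform (density (E.measureAt φ)) η))) ∧
    ∃ Jinf : ℝ, Tendsto (current U φ) atTop (𝓝 Jinf) ∧ 0 < Jinf ∧
      Jinf = 1 / (2 * π) * ∫ θ : AddCircle (2 * π),
        4 * density (E.measureAt φ) θ /
          ((1 + density (E.measureAt φ) θ) ^ 2 +
            4 * hilbertTransform (density (E.measureAt φ)) θ ^ 2) := by
  have hac' := hac.trans absolutelyContinuous_volume_haarAddCircle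
  obtain ⟨g, hg2, hg1, hgn, hg⟩ := exists_boundary_value hE hφ hac'
  refine ⟨hg.mono fun η h => h.1, _, tendsto_current U hφ, ?_⟩
  set ρ := density (E.measureAt φ)
  have hρ0 : ∀ θ, 0 ≤ ρ θ := density_nonneg _
  have hpos : ∀ θ, 0 < (1 + ρ θ) ^ 2 + 4 * hilbertTransform ρ θ ^ 2 := fun θ =>
    add_pos_of_pos_of_nonneg (pow_pos (by linarith [hρ0 θ]) 2) (by positivity)
  have hgi : Integrable g AddCircle.haarAddCircle := hg2.integrable (by norm_num)
  have hgi2 : Integrable (fun θ => ‖g θ‖ ^ 2) AddCircle.haarAddCircle :=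
    hg2.integrable_norm_pow (by norm_num)
  have hae : (fun θ => 2 * (g θ).re - ‖g θ‖ ^ 2) =ᵐ[AddCircle.haarAddCircle] fun θ =>
      4 * ρ θ / ((1 + ρ θ) ^ 2 + 4 * hilbertTransform ρ θ ^ 2) := by
    refine absolutelyContinuous_haarAddCircle_volume.ae_le ?_
    filter_upwards [hg] with θ ⟨_, _, h⟩
    rw [inv_eq_iff_eq_inv] at h
    have hn : Complex.normSq ⟨(1 + ρ θ) / 2, hilbertTransform ρ θ⟩ =
        ((1 + ρ θ) ^ 2 + 4 * hilbertTransform ρ θ ^ 2) / 4 := by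
      rw [Complex.normSq_mk]; ring
    rw [← Complex.normSq_eq_norm_sq, h, Complex.inv_re, map_inv₀, hn]
    have := (hpos θ).ne'
    field_simp
    ring
  have hint : Integrable (fun θ => 2 * (g θ).re - ‖g θ‖ ^ 2) AddCircle.haarAddCircle :=
    (hgi.re.const_mul 2).sub hgi2
  have hval : ∫ θ, 4 * ρ θ / ((1 + ρ θ) ^ 2 + 4 * hilbertTransform ρ θ ^ 2)
      ∂AddCircle.haarAddCircle = 2 - ∑' k, ‖survivalCoeff U φ k‖ ^ 2 := by
    have hre : ∫ θ, (g θ).re ∂AddCircle.haarAddCircle = 1 := by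
      have h : ∫ θ, (g θ).re ∂AddCircle.haarAddCircle =
        (∫ θ, g θ ∂AddCircle.haarAddCircle).re := integral_re hgi
      rw [h, hg1, Complex.one_re]
    have hgre : Integrable (fun θ => 2 * (g θ).re) AddCircle.haarAddCircle := hgi.re.const_mul 2
    rw [← integral_congr_ae hae, integral_sub hgre hgi2, hgn, integral_const_mul, hre, mul_one]
  have hnn : ∀ θ, 0 ≤ 4 * ρ θ / ((1 + ρ θ) ^ 2 + 4 * hilbertTransform ρ θ ^ 2) := fun θ =>
    div_nonneg (mul_nonneg (by norm_num) (hρ0 θ)) (hpos θ).le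
  constructor
  · rw [← hval]
    refine lt_of_le_of_ne (integral_nonneg hnn) fun h0 => ?_
    -- a vanishing integral forces `ρ = 0` almost everywhere, against `∫ ρ = 1`
    have hz := (integral_eq_zero_iff_of_nonneg hnn (hint.congr hae)).1 h0.symm
    have hρz : ρ =ᵐ[AddCircle.haarAddCircle] 0 := by
      filter_upwards [hz] with θ hθ
      have h4 := (div_eq_zero_iff.1 hθ).resolve_right (hpos θ).ne'
      simpa using h4
    have h1 := integral_density hφ hac'
    rw [integral_congr_ae hρz] at h1
    simp at h1
  · rw [← hval, AddCircle.integral_haarAddCircle, smul_eq_mul, one_div]
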